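/- Let $N\in\mathbb N$, $p>1$, $s\in(0,1)$ with $N>ps$, $c_0>0$, $\delta>0$, $0<h_{\min}<h_{\max}$, and $p'=p/(p-1)$. Let $\Omega\subset\mathbb R^N$ be a bounded open set and $\Omega_\delta=\Omega\cup\bigcup_{q\in\partial\Omega}B(q,\delta)$. Let $z\mapsto k(|z|)$ be a nonnegative, radial, integrable kernel on $\mathbb R^N$ that vanishes outside $B(0,\delta)$ and satisfies $$\frac1{C_N}\int_{B(0,\delta)}k(|z|)\,dz=1,\qquad k(|z|)\ge\frac{c_0}{|z|^{N+(s-1)p}}\quad(0<|z|<\delta),$$ where $C_N=\frac{1}{\sigma(S^{N-1})}\int_{S^{N-1}}|\omega\cdot e|^p\,d\sigma(\omega)$, $e$ is any unit vector and $\sigma$ is the $(N-1)$-dimensional Hausdorff measure. Let $h:\Omega_\delta\to\mathbb R$ be measurable with $h\in[h_{\min},h_{\max}]$ a.e. in $\Omega$ and $h=0$ a.e. in $\Omega_\delta\setminus\Omega$, and put $H(x',x)=\frac{h(x')+h(x)}2$ and $$B_h(u,v)=\int_{\Omega_\delta}\int_{\Omega_\delta}H(x',x)\,k(|x'-x|)\,\frac{|u(x')-u(x)|^{p-2}(u(x')-u(x))}{|x'-x|^p}\,(v(x')-v(x))\,dx'\,dx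 .$$ Let $B$ be the same expression with $H$ replaced by $1$, and let $X=\{u\in L^p(\Omega_\delta):B(u,u)<\infty\}$ and $X_0=\{u\in X:u=0\text{ a.e. in }\Omega_\delta\setminus\Omega\}$, functions being identified when they agree a.e. in $\Omega_\delta$. Let $u_0$ be the restriction to $\Omega_\delta\setminus\Omega$ of an element of $X$, let $u_0+X_0$ denote the set of all $u\in X$ with $u=u_0$ a.e. in $\Omega_\delta\setminus\Omega$, and let $g\in L^{p'}(\Omega)$. Then the nonlocal Dirichlet problem $$B_h(u,w)=\int_\Omega g\,w\,dx\quad\text{for all }w\in X_0,\qquad u=u_0\ \text{ in }\Omega_\delta\setminus\Omega,$$ has a unique solution $u\in u_0+X_0$. Moreover, an element $u\in u_0+X_0$ solves this problem if and only if it minimizes $$\mathcal J(w)=\frac1p B_h(w,w)-\int_\Omega g\,w\,dx$$ over $w\in u_0+X_0$. -/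

import Mathlib

open MeasureTheory Set

noncomputable section

/-- The `N`-dimensional Euclidean space. -/
abbrev Euc (N : ℕ) : Type := EuclideanSpace ℝ (Fin N)

/-- The enlarged domain: the union of `Ω` and all open balls of radius `δ` centred on its
boundary. -/
def enlarged {N : ℕ} (Ω : Set (Euc N)) (δ : ℝ) : Set (Euc N) :=
  Ω ∪ ⋃ q ∈ frontier Ω, Metric.ball q δ

/-- The mean of `|ω · e| ^ p` over the unit sphere, with respect to the
`(N - 1)`-dimensional Hausdorff measure. -/
def sphereMean (N : ℕ) (p : ℝ) (e : Euc N) : ℝ :=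
  (1 / (Measure.hausdorffMeasure ((N : ℝ) - 1) (Metric.sphere (0 : Euc N) 1)).toReal) *
    ∫ ω in Metric.sphere (0 : Euc N) 1, |inner ℝ ω e| ^ p
      ∂(Measure.hausdorffMeasure ((N : ℝ) - 1))

/-- Admissible radial kernels `z ↦ k ‖z‖` of horizon `δ`. -/
structure IsKernel (N : ℕ) (p s c₀ δ : ℝ) (k : ℝ → ℝ) : Prop where
  nonneg : ∀ r, 0 ≤ r → 0 ≤ k r
  support_subset : Function.support (fun z : Euc N => k ‖z‖) ⊆ Metric.ball 0 δ
  integrableOn : IntegrableOn (fun z : Euc N => k ‖z‖) (Metric.ball 0 δ)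
  normalized : ∀ e : Euc N, ‖e‖ = 1 →
    (1 / sphereMean N p e) * ∫ z in Metric.ball (0 : Euc N) δ, k ‖z‖ = 1
  lower_bound : ∀ z : Euc N, z ≠ 0 → ‖z‖ < δ → c₀ / ‖z‖ ^ ((N : ℝ) + (s - 1) * p) ≤ k ‖z‖

/-- The diffusion coefficients. -/
structure IsCoefficient {N : ℕ} (Ω : Set (Euc N)) (δ hmin hmax : ℝ) (h : Euc N → ℝ) :
    Prop where
  aemeasurable : AEMeasurable h (volume.restrict (enlarged Ω δ))
  mem_Icc : ∀ᵐ x ∂(volume.restrict Ω), h x ∈ Icc hmin hmax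
  eq_zero : ∀ᵐ x ∂(volume.restrict (enlarged Ω δ \ Ω)), h x = 0

/-- The integrand `H(x', x) k(|x' - x|) |u(x') - u(x)|^(p-2) (u(x') - u(x)) (v(x') - v(x)) /
|x' - x|^p`. -/
def formIntegrand {N : ℕ} (H : Euc N → Euc N → ℝ) (k : ℝ → ℝ) (p : ℝ) (u v : Euc N → ℝ)
    (x' x : Euc N) : ℝ :=
  H x' x * k ‖x' - x‖ * (|u x' - u x| ^ (p - 2) * (u x' - u x) / ‖x' - x‖ ^ p) * (v x' - v x)

/-- The weighted form `B_h(u, v)`, with weight `H(x', x) = (h(x') + h(x)) / 2`. -/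
def weightedForm {N : ℕ} (Ω : Set (Euc N)) (δ : ℝ) (k : ℝ → ℝ) (p : ℝ) (h : Euc N → ℝ)
    (u v : Euc N → ℝ) : ℝ :=
  ∫ x in enlarged Ω δ, ∫ x' in enlarged Ω δ,
    formIntegrand (fun y' y => (h y' + h y) / 2) k p u v x' x

/-- The unweighted energy `B(u, u)`, whose integrand is nonnegative, with values in
`[0, ∞]`. -/
def energy {N : ℕ} (Ω : Set (Euc N)) (δ : ℝ) (k : ℝ → ℝ) (p : ℝ) (u : Euc N → ℝ) : ENNReal :=
  ∫⁻ x in enlarged Ω δ, ∫⁻ x' in enlarged Ω δ,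
    ENNReal.ofReal (formIntegrand (fun _ _ => 1) k p u u x' x)

/-- The Lebesgue space `L^p` on the enlarged domain (functions up to a.e. equality). -/
abbrev LpEnlarged {N : ℕ} (Ω : Set (Euc N)) (δ p : ℝ) : Type :=
  Lp ℝ (ENNReal.ofReal p) (volume.restrict (enlarged Ω δ))

/-- The nonlocal energy space `X`. -/
def energySpace {N : ℕ} (Ω : Set (Euc N)) (δ : ℝ) (k : ℝ → ℝ) (p : ℝ) :
    Set (LpEnlarged Ω δ p) :=
  {u | energy Ω δ k p u < ⊤}

/-- The constrained energy space `X₀`: elements of `X` that vanish outside `Ω`. -/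
def energySpaceZero {N : ℕ} (Ω : Set (Euc N)) (δ : ℝ) (k : ℝ → ℝ) (p : ℝ) :
    Set (LpEnlarged Ω δ p) :=
  {u | u ∈ energySpace Ω δ k p ∧ ∀ᵐ x ∂(volume.restrict (enlarged Ω δ \ Ω)), u x = 0}

/-- The trace space: functions that agree on `Ω_δ \ Ω` with an element of `X`
(their values elsewhere play no role). -/
def traceSpace {N : ℕ} (Ω : Set (Euc N)) (δ : ℝ) (k : ℝ → ℝ) (p : ℝ) : Set (Euc N → ℝ) :=
  {u₀ | ∃ U ∈ energySpace Ω δ k p, ∀ᵐ x ∂(volume.restrict (enlarged Ω δ \ Ω)), U x = u₀ x}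

/-- The convex set `u₀ + X₀`: elements of `X` that agree with `u₀` on `Ω_δ \ Ω`. -/
def admissible {N : ℕ} (Ω : Set (Euc N)) (δ : ℝ) (k : ℝ → ℝ) (p : ℝ) (u₀ : Euc N → ℝ) :
    Set (LpEnlarged Ω δ p) :=
  {u | u ∈ energySpace Ω δ k p ∧ ∀ᵐ x ∂(volume.restrict (enlarged Ω δ \ Ω)), u x = u₀ x}

/-- `u` solves the nonlocal Dirichlet problem with source `g` and boundary datum `u₀`. -/
def IsSolution {N : ℕ} (Ω : Set (Euc N)) (δ : ℝ) (k : ℝ → ℝ) (p : ℝ) (h g u₀ : Euc N → ℝ)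
    (u : LpEnlarged Ω δ p) : Prop :=
  u ∈ admissible Ω δ k p u₀ ∧
    ∀ w ∈ energySpaceZero Ω δ k p, weightedForm Ω δ k p h u w = ∫ x in Ω, g x * w x

/-- The energy functional `J(w) = B_h(w, w) / p - ∫_Ω g w`. -/
def functionalJ {N : ℕ} (Ω : Set (Euc N)) (δ : ℝ) (k : ℝ → ℝ) (p : ℝ) (h g : Euc N → ℝ)
    (w : LpEnlarged Ω δ p) : ℝ :=
  (1 / p) * weightedForm Ω δ k p h w w - ∫ x in Ω, g x * w x

end

/-! Let `ν` be the measure on pairs `(x, x')` with density `H k / |x' - x| ^ p`, and let `T u =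
u(x') - u(x)`, viewed in `L^p(ν)`. Then `B_h(w, w) = ‖T w‖ ^ p`, so on `u₀ + X₀` the functional `J`
is, up to an additive constant, `‖f₀ + T v‖ ^ p / p - ℓ v` with `f₀` the image of one admissible
function, `v ∈ X₀` and `ℓ` linear.

Existence follows from the uniform convexity of `L^p(ν)` (`Lp.uniformlyConvex`), which makes `T v_n`
Cauchy along a minimizing sequence, so that norm convergence replaces weak compactness. This needs
`|ℓ v| ≤ C ‖T v‖` on `X₀` and a closed range of `T` on `X₀`. Both rest on the estimate `‖v‖_p ≤ C ‖T
v‖` (`exists_norm_le`), which also turns uniqueness of `T v` into uniqueness of `v`.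

That estimate has two sources. `H` vanishes on pairs lying outside `Ω`, but so does `T v`; on all
other pairs `H ≥ hmin / 2` (`lintegral_energy_le_weighted`). And a Poincaré inequality holds
(`exists_poincare`): repeating a shift of length between `δ / 2` and `δ` moves `Ω` off itself, while
`k` is bounded below at the nonzero distances less than `δ`.

For the equivalence, convexity of `|·| ^ p` shows that solutions minimize, and differentiating `t ↦
J(u + t w)` at `0` gives the converse. -/

/-! ### Quantitative convexity of `|·| ^ p` on the real line. -/

theorem abs_rpow_midpoint_lt {p : ℝ} (hp : 1 < p) {a b : ℝ} (hab : a ≠ b) :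
    |(a + b) / 2| ^ p < (|a| ^ p + |b| ^ p) / 2 := by
  have hp0 : 0 < p := by linarith
  by_cases h : |a| = |b|
  · rcases abs_eq_abs.1 h with h | h
    · exact absurd h hab
    · have hb : b ≠ 0 := by
        rintro rfl
        exact hab (by simpa using h)
      have := Real.rpow_pos_of_pos (abs_pos.2 hb) p
      subst h
      simpa [Real.zero_rpow hp0.ne'] using this
  · have h1 := (strictConvexOn_rpow hp).2 (abs_nonneg a) (abs_nonneg b) h
      (show (0 : ℝ) < 1 / 2 by norm_num) (show (0 : ℝ) < 1 / 2 by norm_num) (by norm_num)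
    simp only [smul_eq_mul] at h1
    have h2 : |(a + b) / 2| ≤ 1 / 2 * |a| + 1 / 2 * |b| := by
      rw [abs_div, abs_two]
      linarith [abs_add_le a b]
    have h3 := Real.rpow_le_rpow (abs_nonneg _) h2 hp0.le
    linarith

theorem abs_rpow_midpoint_le {p : ℝ} (hp : 1 < p) (a b : ℝ) :
    |(a + b) / 2| ^ p ≤ (|a| ^ p + |b| ^ p) / 2 := by
  rcases eq_or_ne a b with rfl | h
  · simp
  · exact (abs_rpow_midpoint_lt hp h).le

/-- The Jensen defect of `|·| ^ p` controls `|a - b| ^ p` up to an arbitrarily small multiple of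
`|a| ^ p + |b| ^ p`. -/
theorem exists_abs_sub_rpow_le {p : ℝ} (hp : 1 < p) {ε : ℝ} (hε : 0 < ε) :
    ∃ C : ℝ, 0 ≤ C ∧ ∀ a b : ℝ, |a - b| ^ p ≤
      ε * (|a| ^ p + |b| ^ p) + C * ((|a| ^ p + |b| ^ p) / 2 - |(a + b) / 2| ^ p) := by
  have hp0 : 0 < p := by linarith
  have hc1 : Continuous fun x : ℝ × ℝ => |x.1 - x.2| ^ p :=
    (by fun_prop : Continuous fun x : ℝ × ℝ => |x.1 - x.2|).rpow_const (fun _ => Or.inr hp0.le)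
  have hc2 : Continuous fun x : ℝ × ℝ => |x.1| ^ p :=
    (by fun_prop : Continuous fun x : ℝ × ℝ => |x.1|).rpow_const (fun _ => Or.inr hp0.le)
  have hc3 : Continuous fun x : ℝ × ℝ => |x.2| ^ p :=
    (by fun_prop : Continuous fun x : ℝ × ℝ => |x.2|).rpow_const (fun _ => Or.inr hp0.le)
  have hc4 : Continuous fun x : ℝ × ℝ => |(x.1 + x.2) / 2| ^ p :=
    (by fun_prop : Continuous fun x : ℝ × ℝ => |(x.1 + x.2) / 2|).rpow_const
      (fun _ => Or.inr hp0.le)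
  -- On this compact set `a ≠ b`, so the continuous Jensen defect has a positive lower bound `η`,
  -- while `|a - b| ^ p ≤ 2 ^ p`. Hence the constant `2 ^ p / η`.
  have hK : IsCompact (Metric.sphere (0 : ℝ × ℝ) 1 ∩ {x | ε ≤ |x.1 - x.2| ^ p}) :=
    (isCompact_sphere _ _).inter_right (isClosed_le continuous_const hc1)
  obtain ⟨η, hη, hηK⟩ := hK.exists_forall_le' (a := 0)
    (f := fun x : ℝ × ℝ => (|x.1| ^ p + |x.2| ^ p) / 2 - |(x.1 + x.2) / 2| ^ p)
    (((hc2.add hc3).div_const 2).sub hc4).continuousOn (by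
      rintro ⟨a, b⟩ ⟨-, hx⟩
      have hab : a ≠ b := by
        rintro rfl
        simp only [mem_ofPred_eq, sub_self, abs_zero, Real.zero_rpow hp0.ne'] at hx
        linarith
      simpa using abs_rpow_midpoint_lt hp hab)
  have key : ∀ a b : ℝ, ‖(a, b)‖ = 1 → |a - b| ^ p ≤
      ε * (|a| ^ p + |b| ^ p) +
        (2 ^ p / η) * ((|a| ^ p + |b| ^ p) / 2 - |(a + b) / 2| ^ p) := by
    intro a b hab
    have hmax : max |a| |b| = 1 := by simpa [Prod.norm_def] using hab
    have ha0 := Real.rpow_nonneg (abs_nonneg a) p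
    have hb0 := Real.rpow_nonneg (abs_nonneg b) p
    have hd := abs_rpow_midpoint_le hp a b
    have hC : 0 ≤ (2 : ℝ) ^ p / η := by positivity
    by_cases hlt : ε ≤ |a - b| ^ p
    · have h1 : η ≤ (|a| ^ p + |b| ^ p) / 2 - |(a + b) / 2| ^ p :=
        hηK (a, b) ⟨by simpa using hab, hlt⟩
      have h2 : |a - b| ^ p ≤ 2 ^ p := by
        refine Real.rpow_le_rpow (abs_nonneg _) ?_ hp0.le
        have := abs_sub a b
        have := le_max_left |a| |b|
        have := le_max_right |a| |b|
        linarith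
      have h3 : (2 : ℝ) ^ p / η * η ≤
          2 ^ p / η * ((|a| ^ p + |b| ^ p) / 2 - |(a + b) / 2| ^ p) :=
        mul_le_mul_of_nonneg_left h1 hC
      rw [div_mul_cancel₀ _ hη.ne'] at h3
      have : 0 ≤ ε * (|a| ^ p + |b| ^ p) := by positivity
      linarith
    -- Off that set `|a - b| ^ p < ε`, and the `ε` term alone suffices, since one of `|a|`, `|b|`
    -- equals `1`.
    · have h1 : 1 ≤ |a| ^ p + |b| ^ p := by
        rcases max_choice |a| |b| with h | h
        · rw [h] at hmax
          simp only [hmax, Real.one_rpow]; linarith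
        · rw [h] at hmax
          simp only [hmax, Real.one_rpow]; linarith
      have h2 : 0 ≤ 2 ^ p / η * ((|a| ^ p + |b| ^ p) / 2 - |(a + b) / 2| ^ p) :=
        mul_nonneg hC (by linarith)
      nlinarith
  -- Both sides are homogeneous of degree `p`, which reduces the claim to the unit sphere.
  refine ⟨2 ^ p / η, by positivity, fun a b => ?_⟩
  by_cases h0 : (a, b) = (0 : ℝ × ℝ)
  · obtain ⟨rfl, rfl⟩ : a = 0 ∧ b = 0 := by simpa using h0
    simp [Real.zero_rpow hp0.ne']
  · set r := ‖(a, b)‖ with hr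
    have hr0 : 0 < r := norm_pos_iff.2 h0
    have h := key (r⁻¹ * a) (r⁻¹ * b) (by
      have : ((r⁻¹ * a, r⁻¹ * b) : ℝ × ℝ) = r⁻¹ • (a, b) := by simp
      rw [this, norm_smul, ← hr, Real.norm_of_nonneg (by positivity), inv_mul_cancel₀ hr0.ne'])
    have hs : ∀ x : ℝ, |r⁻¹ * x| ^ p = r⁻¹ ^ p * |x| ^ p := fun x => by
      rw [abs_mul, abs_of_pos (inv_pos.2 hr0), Real.mul_rpow (by positivity) (abs_nonneg _)]
    rw [← mul_sub, ← mul_add, mul_div_assoc, hs, hs, hs, hs] at h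
    have hrp : 0 < r⁻¹ ^ p := by positivity
    refine le_of_mul_le_mul_left ?_ hrp
    linarith

/-! ### Abstract minimization under uniform convexity. -/

/-- Minimization of `v ↦ ‖f₀ + T v‖ ^ p / p - ℓ v` in a complete normed space whose norm is
uniformly convex in the power form. -/
theorem exists_minimizer_of_uniformlyConvex {E V : Type*} [NormedAddCommGroup E]
    [NormedSpace ℝ E] [CompleteSpace E] [AddCommGroup V] [Module ℝ V] {p : ℝ} (hp : 1 < p)
    (hE : ∀ ε : ℝ, 0 < ε → ∃ C : ℝ, 0 ≤ C ∧ ∀ f g : E, ‖f - g‖ ^ p ≤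
      ε * (‖f‖ ^ p + ‖g‖ ^ p) +
        C * ((‖f‖ ^ p + ‖g‖ ^ p) / 2 - ‖(1 / 2 : ℝ) • (f + g)‖ ^ p))
    (T : V →ₗ[ℝ] E) (hT : IsClosed (range T)) (ℓ : V →ₗ[ℝ] ℝ) {C : ℝ} (hC : 0 ≤ C)
    (hℓ : ∀ v, |ℓ v| ≤ C * ‖T v‖) (f₀ : E) :
    ∃ v, ∀ w, 1 / p * ‖f₀ + T v‖ ^ p - ℓ v ≤ 1 / p * ‖f₀ + T w‖ ^ p - ℓ w := by
  have hp0 : 0 < p := by linarith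
  set J : V → ℝ := fun v => 1 / p * ‖f₀ + T v‖ ^ p - ℓ v with hJ
  -- The linear term is absorbed by half of `r ^ p / p`; the other half keeps `J` coercive. `R`
  -- solves `R ^ (p - 1) = 2 * p * C`.
  obtain ⟨K, hK⟩ : ∃ K : ℝ, ∀ r : ℝ, 0 ≤ r → C * r ≤ r ^ p / (2 * p) + K := by
    set R := (2 * p * C) ^ (1 / (p - 1)) with hR
    have hR0 : 0 ≤ R := by positivity
    refine ⟨C * R, fun r hr => ?_⟩
    rcases le_total r R with h | h
    · have : C * r ≤ C * R := mul_le_mul_of_nonneg_left h hC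
      have : 0 ≤ r ^ p / (2 * p) := by positivity
      linarith
    · have h1 : 2 * p * C ≤ r ^ (p - 1) := by
        calc 2 * p * C = R ^ (p - 1) := by
              rw [hR, ← Real.rpow_mul (by positivity), one_div_mul_cancel (by linarith),
                Real.rpow_one]
          _ ≤ r ^ (p - 1) := Real.rpow_le_rpow hR0 h (by linarith)
      have h2 : r ^ p = r ^ (p - 1) * r := by
        rcases hr.eq_or_lt with rfl | hr
        · simp [Real.zero_rpow hp0.ne']
        · rw [Real.rpow_sub_one hr.ne']; field_simp
      have h3 : C * r ≤ r ^ p / (2 * p) := by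
        rw [le_div_iff₀ (by positivity), h2]
        nlinarith
      have : 0 ≤ C * R := by positivity
      linarith
  have hlow : ∀ v, ‖f₀ + T v‖ ^ p / (2 * p) - (K + C * ‖f₀‖) ≤ J v := by
    intro v
    have h1 := hK _ (norm_nonneg (f₀ + T v))
    have h2 : ‖T v‖ ≤ ‖f₀ + T v‖ + ‖f₀‖ := by
      simpa using norm_sub_le (f₀ + T v) f₀
    have h3 := (le_abs_self _).trans ((hℓ v).trans (mul_le_mul_of_nonneg_left h2 hC))
    have h4 : 1 / p * ‖f₀ + T v‖ ^ p = 2 * (‖f₀ + T v‖ ^ p / (2 * p)) := by field_simp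
    simp only [hJ, h4]
    linarith
  have hbdd : BddBelow (range J) := by
    refine ⟨-(K + C * ‖f₀‖), ?_⟩
    rintro _ ⟨v, rfl⟩
    have : 0 ≤ ‖f₀ + T v‖ ^ p / (2 * p) := by positivity
    linarith [hlow v]
  set m := sInf (range J) with hm
  have hmle : ∀ v, m ≤ J v := fun v => csInf_le hbdd ⟨v, rfl⟩
  have hseq : ∀ n : ℕ, ∃ v, J v < m + 1 / ((n : ℝ) + 1) := fun n => by
    obtain ⟨_, ⟨v, rfl⟩, hv⟩ := exists_lt_of_csInf_lt (range_nonempty J)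
      (show sInf (range J) < m + 1 / ((n : ℝ) + 1) from
        lt_add_of_pos_right _ Nat.one_div_pos_of_nat)
    exact ⟨v, hv⟩
  choose v hv using hseq
  set M := 2 * p * (m + 1 + (K + C * ‖f₀‖)) with hM
  have hMn : ∀ n, ‖f₀ + T (v n)‖ ^ p ≤ M := fun n => by
    have h1 := hlow (v n)
    have h2 := hv n
    have h3 : 1 / ((n : ℝ) + 1) ≤ 1 := by
      rw [div_le_one (by positivity)]; linarith [n.cast_nonneg (α := ℝ)]
    have h4 : ‖f₀ + T (v n)‖ ^ p / (2 * p) ≤ m + 1 + (K + C * ‖f₀‖) := by linarith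
    rw [div_le_iff₀ (by positivity)] at h4
    linarith
  have hM0 : 0 ≤ M := (by positivity : 0 ≤ ‖f₀ + T (v 0)‖ ^ p).trans (hMn 0)
  -- The midpoint of `v i` and `v j` is a competitor. As `ℓ` is linear it cancels, and the Jensen
  -- defect is bounded by the distances of the two values from the infimum.
  have hdef : ∀ i j, (‖f₀ + T (v i)‖ ^ p + ‖f₀ + T (v j)‖ ^ p) / 2 -
      ‖(1 / 2 : ℝ) • ((f₀ + T (v i)) + (f₀ + T (v j)))‖ ^ p ≤
        p * (1 / ((i : ℝ) + 1) + 1 / ((j : ℝ) + 1)) := by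
    intro i j
    have h1 := hmle ((1 / 2 : ℝ) • (v i + v j))
    have h2 : f₀ + T ((1 / 2 : ℝ) • (v i + v j)) =
        (1 / 2 : ℝ) • ((f₀ + T (v i)) + (f₀ + T (v j))) := by
      rw [map_smul, map_add]; module
    have h3 := hv i
    have h4 := hv j
    have h5 : 0 ≤ 1 / ((i : ℝ) + 1) := by positivity
    have h6 : 0 ≤ 1 / ((j : ℝ) + 1) := by positivity
    simp only [hJ] at h1 h3 h4
    rw [h2] at h1
    simp only [map_smul, map_add, smul_eq_mul] at h1
    set A := ‖f₀ + T (v i)‖ ^ p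
    set B := ‖f₀ + T (v j)‖ ^ p
    set D := ‖(1 / 2 : ℝ) • ((f₀ + T (v i)) + (f₀ + T (v j)))‖ ^ p
    have h7 : 1 / p * ((A + B) / 2 - D) ≤ 1 / ((i : ℝ) + 1) + 1 / ((j : ℝ) + 1) := by
      linarith
    calc (A + B) / 2 - D = p * (1 / p * ((A + B) / 2 - D)) := by field_simp
      _ ≤ _ := mul_le_mul_of_nonneg_left h7 hp0.le
  have hcauchy : CauchySeq fun n => T (v n) := by
    rw [Metric.cauchySeq_iff]
    intro η hη
    have hηp : 0 < η ^ p := by positivity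
    -- The norm powers add up to at most `2 * M`, so this `ε` leaves less than `η ^ p / 2` for the
    -- first term; `n₀` does the same for the defect term.
    obtain ⟨C', hC', hCf⟩ := hE (η ^ p / (4 * (M + 1))) (by positivity)
    obtain ⟨n₀, hn₀⟩ := exists_nat_one_div_lt (show 0 < η ^ p / (4 * p * (C' + 1)) by positivity)
    refine ⟨n₀, fun i hi j hj => ?_⟩
    have hle : ∀ i : ℕ, n₀ ≤ i → 1 / ((i : ℝ) + 1) ≤ η ^ p / (4 * p * (C' + 1)) := fun i hi =>
      (one_div_le_one_div_of_le (by positivity) (by gcongr)).trans hn₀.le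
    have h1 := hCf (f₀ + T (v i)) (f₀ + T (v j))
    rw [add_sub_add_left_eq_sub] at h1
    have h2 : η ^ p / (4 * (M + 1)) * (‖f₀ + T (v i)‖ ^ p + ‖f₀ + T (v j)‖ ^ p) <
        η ^ p / 2 := by
      have : η ^ p / (4 * (M + 1)) * (‖f₀ + T (v i)‖ ^ p + ‖f₀ + T (v j)‖ ^ p) ≤
          η ^ p / (4 * (M + 1)) * (2 * M) :=
        mul_le_mul_of_nonneg_left (by linarith [hMn i, hMn j]) (by positivity)
      refine this.trans_lt ?_
      rw [div_mul_eq_mul_div, div_lt_div_iff₀ (by positivity) (by positivity)]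
      nlinarith
    have h3 : C' * ((‖f₀ + T (v i)‖ ^ p + ‖f₀ + T (v j)‖ ^ p) / 2 -
        ‖(1 / 2 : ℝ) • ((f₀ + T (v i)) + (f₀ + T (v j)))‖ ^ p) ≤ η ^ p / 2 := by
      have h4 : p * (1 / ((i : ℝ) + 1) + 1 / ((j : ℝ) + 1)) ≤
          p * (2 * (η ^ p / (4 * p * (C' + 1)))) :=
        mul_le_mul_of_nonneg_left (by linarith [hle i hi, hle j hj]) hp0.le
      refine (mul_le_mul_of_nonneg_left ((hdef i j).trans h4) hC').trans ?_
      have : C' * (p * (2 * (η ^ p / (4 * p * (C' + 1))))) = C' / (C' + 1) * (η ^ p / 2) := by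
        field_simp; ring
      rw [this]
      exact mul_le_of_le_one_left (by positivity) ((div_le_one (by positivity)).2 (by linarith))
    rw [dist_eq_norm]
    exact (Real.rpow_lt_rpow_iff (norm_nonneg _) hη.le hp0).1 (by linarith)
  obtain ⟨f, hf⟩ := cauchySeq_tendsto_of_complete hcauchy
  obtain ⟨w, rfl⟩ : f ∈ range T :=
    hT.mem_of_tendsto hf (Filter.Eventually.of_forall fun n => ⟨_, rfl⟩)
  refine ⟨w, fun z => ?_⟩
  have hnorm : Filter.Tendsto (fun n => 1 / p * ‖f₀ + T (v n)‖ ^ p) Filter.atTop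
      (nhds (1 / p * ‖f₀ + T w‖ ^ p)) :=
    (((tendsto_const_nhds.add hf).norm).rpow_const (Or.inr hp0.le)).const_mul _
  have hlin : Filter.Tendsto (fun n => ℓ (v n)) Filter.atTop (nhds (ℓ w)) := by
    rw [tendsto_iff_norm_sub_tendsto_zero] at hf ⊢
    refine squeeze_zero (fun _ => norm_nonneg _) (fun n => ?_) (by simpa using hf.const_mul C)
    simpa using hℓ (v n - w)
  have hJw : J w ≤ m := by
    refine le_of_tendsto_of_tendsto' (hnorm.sub hlin)
      (show Filter.Tendsto (fun n : ℕ => m + 1 / ((n : ℝ) + 1)) Filter.atTop (nhds m) by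
        simpa using tendsto_const_nhds.add (tendsto_one_div_add_atTop_nhds_zero_nat (𝕜 := ℝ)))
      (fun n => (hv n).le)
  exact hJw.trans (hmle z)

/-- The midpoint of two minimizers is no better than either, so their Jensen defect is at most zero,
and letting `ε → 0` in `hE` gives the claim. Only the images agree, since `T` is not assumed
injective. -/
theorem eq_of_minimizers_of_uniformlyConvex {E V : Type*} [NormedAddCommGroup E]
    [NormedSpace ℝ E] [AddCommGroup V] [Module ℝ V] {p : ℝ} (hp : 1 < p)
    (hE : ∀ ε : ℝ, 0 < ε → ∃ C : ℝ, 0 ≤ C ∧ ∀ f g : E, ‖f - g‖ ^ p ≤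
      ε * (‖f‖ ^ p + ‖g‖ ^ p) +
        C * ((‖f‖ ^ p + ‖g‖ ^ p) / 2 - ‖(1 / 2 : ℝ) • (f + g)‖ ^ p))
    (T : V →ₗ[ℝ] E) (ℓ : V →ₗ[ℝ] ℝ) (f₀ : E) {v v' : V}
    (hv : ∀ w, 1 / p * ‖f₀ + T v‖ ^ p - ℓ v ≤ 1 / p * ‖f₀ + T w‖ ^ p - ℓ w)
    (hv' : ∀ w, 1 / p * ‖f₀ + T v'‖ ^ p - ℓ v' ≤ 1 / p * ‖f₀ + T w‖ ^ p - ℓ w) :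
    T v = T v' := by
  have hp0 : 0 < p := by linarith
  have h1 := hv ((1 / 2 : ℝ) • (v + v'))
  have h2 := hv' ((1 / 2 : ℝ) • (v + v'))
  have h3 : f₀ + T ((1 / 2 : ℝ) • (v + v')) =
      (1 / 2 : ℝ) • ((f₀ + T v) + (f₀ + T v')) := by
    rw [map_smul, map_add]; module
  rw [h3] at h1 h2
  simp only [map_smul, map_add, smul_eq_mul] at h1 h2
  set A := ‖f₀ + T v‖ ^ p with hA
  set B := ‖f₀ + T v'‖ ^ p with hB
  set D := ‖(1 / 2 : ℝ) • ((f₀ + T v) + (f₀ + T v'))‖ ^ p with hD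
  have hdef : (A + B) / 2 - D ≤ 0 := by
    have h7 : 1 / p * ((A + B) / 2 - D) ≤ 0 := by linarith
    calc (A + B) / 2 - D = p * (1 / p * ((A + B) / 2 - D)) := by field_simp
      _ ≤ 0 := mul_nonpos_of_nonneg_of_nonpos hp0.le h7
  have hle : ‖T v - T v'‖ ^ p ≤ 0 := by
    have hAB : 0 ≤ A + B := by positivity
    refine le_of_forall_pos_le_add fun ε hε => ?_
    obtain ⟨C, hC, hCf⟩ := hE (ε / (A + B + 1)) (by positivity)
    have h4 := hCf (f₀ + T v) (f₀ + T v')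
    rw [add_sub_add_left_eq_sub] at h4
    have h5 : C * ((A + B) / 2 - D) ≤ 0 := mul_nonpos_of_nonneg_of_nonpos hC hdef
    have h6 : ε / (A + B + 1) * (A + B) ≤ ε := by
      rw [div_mul_eq_mul_div, div_le_iff₀ (by positivity)]
      nlinarith
    linarith
  by_contra hne
  have : 0 < ‖T v - T v'‖ := norm_pos_iff.2 (sub_ne_zero.2 hne)
  exact absurd hle (not_le.2 (by positivity))

/-! ### The `p`-th power of the `L^p` norm: uniform convexity, subgradient and derivative. -/

section Lp

variable {α : Type*} [MeasurableSpace α] {μ : Measure α} {p : ℝ}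

theorem MeasureTheory.MemLp.integrable_abs_rpow (hp : 1 < p) {f : α → ℝ}
    (hf : MemLp f (ENNReal.ofReal p) μ) : Integrable (fun x => |f x| ^ p) μ := by
  have hp0 : 0 < p := by linarith
  have := hf.integrable_norm_rpow (by simpa using hp0) ENNReal.ofReal_ne_top
  simpa [ENNReal.toReal_ofReal hp0.le] using this

theorem MeasureTheory.Lp.norm_rpow_eq_integral (hp : 1 < p) (f : Lp ℝ (ENNReal.ofReal p) μ) :
    ‖f‖ ^ p = ∫ x, |f x| ^ p ∂μ := by
  have hp0 : 0 < p := by linarith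
  have h0 : 0 ≤ ∫ x, |f x| ^ p ∂μ := integral_nonneg fun _ => by positivity
  rw [Lp.norm_def, (Lp.memLp f).eLpNorm_eq_integral_rpow_norm (by simpa using hp0)
    ENNReal.ofReal_ne_top, ENNReal.toReal_ofReal hp0.le, ENNReal.toReal_ofReal (by positivity),
    ← Real.rpow_mul (by simpa using h0), inv_mul_cancel₀ hp0.ne', Real.rpow_one]
  simp

/-- The scalar inequality `exists_abs_sub_rpow_le` can be integrated as it stands, because its
constant does not depend on the two numbers. -/
theorem MeasureTheory.Lp.uniformlyConvex [Fact (1 ≤ ENNReal.ofReal p)] (hp : 1 < p) {ε : ℝ}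
    (hε : 0 < ε) :
    ∃ C : ℝ, 0 ≤ C ∧ ∀ f g : Lp ℝ (ENNReal.ofReal p) μ, ‖f - g‖ ^ p ≤
      ε * (‖f‖ ^ p + ‖g‖ ^ p) +
        C * ((‖f‖ ^ p + ‖g‖ ^ p) / 2 - ‖(1 / 2 : ℝ) • (f + g)‖ ^ p) := by
  obtain ⟨C, hC, h⟩ := exists_abs_sub_rpow_le hp hε
  refine ⟨C, hC, fun f g => ?_⟩
  have hf := (Lp.memLp f).integrable_abs_rpow hp
  have hg := (Lp.memLp g).integrable_abs_rpow hp
  have hm := (Lp.memLp ((1 / 2 : ℝ) • (f + g))).integrable_abs_rpow hp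
  have hs := (Lp.memLp (f - g)).integrable_abs_rpow hp
  have hfg : Integrable (fun x => |f x| ^ p + |g x| ^ p) μ := hf.add hg
  have hfg2 : Integrable (fun x => (|f x| ^ p + |g x| ^ p) / 2) μ := hfg.div_const 2
  have hd : Integrable (fun x => C * ((|f x| ^ p + |g x| ^ p) / 2 -
      |((1 / 2 : ℝ) • (f + g)) x| ^ p)) μ := (hfg2.sub hm).const_mul C
  simp only [Lp.norm_rpow_eq_integral hp]
  rw [← integral_add hf hg, ← integral_const_mul, ← integral_div,
    ← integral_sub hfg2 hm, ← integral_const_mul, ← integral_add (hfg.const_mul ε) hd]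
  refine integral_mono_ae hs ((hfg.const_mul ε).add hd) ?_
  filter_upwards [Lp.coeFn_sub f g, Lp.coeFn_smul (1 / 2 : ℝ) (f + g), Lp.coeFn_add f g]
    with x h1 h2 h3
  have h4 : ((1 / 2 : ℝ) • (f + g)) x = (f x + g x) / 2 := by
    rw [h2, Pi.smul_apply, h3, Pi.add_apply, smul_eq_mul]; ring
  simp only [h1, Pi.sub_apply, h4]
  exact h (f x) (g x)

theorem abs_rpow_sub_two_mul_self (hp : 1 < p) (a : ℝ) : |(|a| ^ (p - 2) * a)| = |a| ^ (p - 1) := by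
  rcases eq_or_ne a 0 with rfl | ha
  · simp [Real.zero_rpow (show p - 1 ≠ 0 by linarith)]
  · have ha' := abs_pos.2 ha
    rw [abs_mul, abs_of_nonneg (by positivity), ← Real.rpow_add_one ha'.ne']
    ring_nf

theorem abs_rpow_sub_two_mul_sq (hp : 1 < p) (a : ℝ) : |a| ^ (p - 2) * a * a = |a| ^ p := by
  rcases eq_or_ne a 0 with rfl | ha
  · simp [Real.zero_rpow (show p ≠ 0 by linarith)]
  · have ha' := abs_pos.2 ha
    rw [mul_assoc, ← abs_mul_abs_self a, ← mul_assoc, ← Real.rpow_add_one ha'.ne',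
      ← Real.rpow_add_one ha'.ne']
    ring_nf

/-- Young's inequality for `|a| ^ (p - 1)` and `|b|`. Taking `a + b` in place of `b` yields the
tangent-line inequality for `|·| ^ p` at `a`. -/
theorem mul_abs_rpow_sub_two_le (hp : 1 < p) (a b : ℝ) :
    p * (|a| ^ (p - 2) * a * b) ≤ (p - 1) * |a| ^ p + |b| ^ p := by
  have hp0 : 0 < p := by linarith
  have hp1 : 0 < p - 1 := by linarith
  have h1 : |a| ^ (p - 2) * a * b ≤ |a| ^ (p - 1) * |b| := by
    rw [← abs_rpow_sub_two_mul_self hp, ← abs_mul]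
    exact le_abs_self _
  have hpq : (p / (p - 1)).HolderConjugate p := (Real.HolderConjugate.conjExponent hp).symm
  have h2 := Real.young_inequality_of_nonneg (Real.rpow_nonneg (abs_nonneg a) (p - 1))
    (abs_nonneg b) hpq
  rw [← Real.rpow_mul (abs_nonneg _), mul_div_cancel₀ _ hp1.ne'] at h2
  calc p * (|a| ^ (p - 2) * a * b) ≤ p * (|a| ^ p / (p / (p - 1)) + |b| ^ p / p) :=
        mul_le_mul_of_nonneg_left (h1.trans h2) hp0.le
    _ = (p - 1) * |a| ^ p + |b| ^ p := by field_simp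

theorem MeasureTheory.MemLp.integrable_abs_rpow_sub_two_mul (hp : 1 < p) {f g : α → ℝ}
    (hf : MemLp f (ENNReal.ofReal p) μ) (hg : MemLp g (ENNReal.ofReal p) μ) :
    Integrable (fun x => |f x| ^ (p - 2) * f x * g x) μ := by
  have hp0 : 0 < p := by linarith
  refine Integrable.mono' (((hf.integrable_abs_rpow hp).const_mul (p - 1)).add
    (hg.integrable_abs_rpow hp) |>.const_mul (1 / p)) ?_ (Filter.Eventually.of_forall fun x => ?_)
  · have h1 := hf.1.aemeasurable
    have h2 := hg.1.aemeasurable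
    exact (by fun_prop : AEMeasurable (fun x => |f x| ^ (p - 2) * f x * g x) μ).aestronglyMeasurable
  · have h : p * |(|f x| ^ (p - 2) * f x * g x)| ≤ (p - 1) * |f x| ^ p + |g x| ^ p := by
      rcases abs_choice (|f x| ^ (p - 2) * f x * g x) with h | h
      · rw [h]; exact mul_abs_rpow_sub_two_le hp _ _
      · have := mul_abs_rpow_sub_two_le hp (f x) (-g x)
        rw [h, ← mul_neg]; simpa using this
    simp only [Real.norm_eq_abs, Pi.add_apply]
    rw [one_div, le_inv_mul_iff₀ hp0]
    exact h

/-- The subgradient inequality for `f ↦ ∫ |f| ^ p`. -/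
theorem integral_abs_rpow_add_le (hp : 1 < p) {f g : α → ℝ}
    (hf : MemLp f (ENNReal.ofReal p) μ) (hg : MemLp g (ENNReal.ofReal p) μ) :
    ∫ x, |f x| ^ p ∂μ + p * ∫ x, |f x| ^ (p - 2) * f x * g x ∂μ ≤
      ∫ x, |f x + g x| ^ p ∂μ := by
  have h1 := hf.integrable_abs_rpow hp
  have h2 := hf.integrable_abs_rpow_sub_two_mul hp hg
  rw [← integral_const_mul, ← integral_add h1 (h2.const_mul p)]
  refine integral_mono (h1.add (h2.const_mul p)) ((hf.add hg).integrable_abs_rpow hp) fun x => ?_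
  have h3 := mul_abs_rpow_sub_two_le hp (f x) (f x + g x)
  rw [mul_add, abs_rpow_sub_two_mul_sq hp] at h3
  linarith

/-- Differentiation under the integral: for `|t| < 1` the derivative of the integrand is dominated
by `p * (|f| + |g|) ^ p`. -/
theorem hasDerivAt_integral_abs_rpow (hp : 1 < p) {f g : α → ℝ}
    (hf : MemLp f (ENNReal.ofReal p) μ) (hg : MemLp g (ENNReal.ofReal p) μ) :
    HasDerivAt (fun t : ℝ => ∫ x, |f x + t * g x| ^ p ∂μ)
      (p * ∫ x, |f x| ^ (p - 2) * f x * g x ∂μ) 0 := by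
  have hp0 : 0 < p := by linarith
  have hb : Integrable (fun x => p * (|(|f x| + |g x|)| ^ p)) μ :=
    ((hf.abs.add hg.abs).integrable_abs_rpow hp).const_mul p
  have hft : ∀ t : ℝ, MemLp (fun x => f x + t * g x) (ENNReal.ofReal p) μ := fun t =>
    hf.add (hg.const_mul t)
  have h := (hasDerivAt_integral_of_dominated_loc_of_deriv_le (μ := μ)
    (F := fun (t : ℝ) x => |f x + t * g x| ^ p)
    (F' := fun (t : ℝ) x => p * (|f x + t * g x| ^ (p - 2) * (f x + t * g x) * g x))
    (x₀ := (0 : ℝ)) (s := Metric.ball 0 1) (Metric.ball_mem_nhds _ one_pos)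
    (Filter.Eventually.of_forall fun t => ((hft t).integrable_abs_rpow hp).1)
    ((hft 0).integrable_abs_rpow hp)
    ((((hft 0).integrable_abs_rpow_sub_two_mul hp hg).const_mul p).1)
    (bound := fun x => p * (|(|f x| + |g x|)| ^ p))
    (Filter.Eventually.of_forall fun x t ht => ?_) hb
    (Filter.Eventually.of_forall fun x t ht => ?_)).2
  · rw [integral_const_mul] at h
    simpa using h
  · have ht' : |t| ≤ 1 := by
      have := mem_ball_zero_iff.1 ht
      exact this.le
    have h1 : |f x + t * g x| ≤ |f x| + |g x| := by
      refine (abs_add_le _ _).trans ?_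
      rw [abs_mul]
      have := mul_le_of_le_one_left (abs_nonneg (g x)) ht'
      linarith
    rw [Real.norm_eq_abs, abs_mul, abs_mul, abs_rpow_sub_two_mul_self hp, abs_of_pos hp0,
      abs_of_nonneg (add_nonneg (abs_nonneg (f x)) (abs_nonneg (g x)))]
    refine mul_le_mul_of_nonneg_left ?_ hp0.le
    have hs : 0 ≤ |f x| + |g x| := by positivity
    calc |f x + t * g x| ^ (p - 1) * |g x|
        ≤ (|f x| + |g x|) ^ (p - 1) * (|f x| + |g x|) := by
          refine mul_le_mul (Real.rpow_le_rpow (abs_nonneg _) h1 (by linarith))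
            (by linarith [abs_nonneg (f x)]) (abs_nonneg _) (by positivity)
      _ = (|f x| + |g x|) ^ p := by
          rcases hs.eq_or_lt with h0 | h0
          · rw [← h0]; simp [Real.zero_rpow hp0.ne']
          · rw [← Real.rpow_add_one h0.ne']; ring_nf
  · have h1 : HasDerivAt (fun t : ℝ => f x + t * g x) (g x) t := by
      simpa using ((hasDerivAt_id t).mul_const (g x)).const_add (f x)
    have h2 : HasDerivAt (fun t : ℝ => |f x + t * g x| ^ p)
        (p * |f x + t * g x| ^ (p - 2) * (f x + t * g x) * g x) t :=
      HasDerivAt.comp (h₂ := fun y : ℝ => |y| ^ p) t (hasDerivAt_abs_rpow _ hp) h1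
    exact h2.congr_deriv (by ring)

end Lp

/-! ### Energies as `L^p` norms of differences on pairs of points. -/

section Pairs

variable {N : ℕ}

/-- The product measure on pairs of points of the enlarged domain. -/
noncomputable def pairMeasure (Ω : Set (Euc N)) (δ : ℝ) : Measure (Euc N × Euc N) :=
  (volume.restrict (enlarged Ω δ)).prod (volume.restrict (enlarged Ω δ))

/-- The difference `u(x') - u(x)` as a function of the pair `(x, x')`. -/
def pairDiff (u : Euc N → ℝ) (z : Euc N × Euc N) : ℝ := u z.2 - u z.1

/-- The weight `a(x', x) k(|x' - x|) / |x' - x| ^ p` at the pair `(x, x')`. -/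
noncomputable def interactionWeight (a : Euc N → Euc N → ℝ) (k : ℝ → ℝ) (p : ℝ)
    (z : Euc N × Euc N) : ℝ :=
  a z.2 z.1 * (k ‖z.2 - z.1‖ / ‖z.2 - z.1‖ ^ p)

/-- The measure on pairs with density `a(x', x) k(|x' - x|) / |x' - x| ^ p`. -/
noncomputable def interactionMeasure (Ω : Set (Euc N)) (δ : ℝ) (k : ℝ → ℝ) (p : ℝ)
    (a : Euc N → Euc N → ℝ) : Measure (Euc N × Euc N) :=
  (pairMeasure Ω δ).withDensity fun z => ENNReal.ofReal (interactionWeight a k p z)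

variable {Ω : Set (Euc N)} {δ p s c₀ hmin hmax : ℝ} {k : ℝ → ℝ} {a : Euc N → Euc N → ℝ}
  {h u v : Euc N → ℝ}

theorem formIntegrand_eq_weight_mul (a : Euc N → Euc N → ℝ) (k : ℝ → ℝ) (p : ℝ)
    (u v : Euc N → ℝ) (z : Euc N × Euc N) :
    formIntegrand a k p u v z.2 z.1 =
      interactionWeight a k p z * (|pairDiff u z| ^ (p - 2) * pairDiff u z * pairDiff v z) := by
  simp only [formIntegrand, interactionWeight, pairDiff]
  ring

theorem isOpen_enlarged (hΩ : IsOpen Ω) (δ : ℝ) : IsOpen (enlarged Ω δ) :=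
  hΩ.union (isOpen_biUnion fun _ _ => Metric.isOpen_ball)

theorem subset_enlarged (Ω : Set (Euc N)) (δ : ℝ) : Ω ⊆ enlarged Ω δ := subset_union_left

theorem aemeasurable_pairDiff (hu : AEMeasurable u (volume.restrict (enlarged Ω δ))) :
    AEMeasurable (pairDiff u) (pairMeasure Ω δ) :=
  (hu.comp_quasiMeasurePreserving Measure.quasiMeasurePreserving_snd).sub
    (hu.comp_quasiMeasurePreserving Measure.quasiMeasurePreserving_fst)

theorem pairDiff_congr (huv : u =ᵐ[volume.restrict (enlarged Ω δ)] v) :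
    pairDiff u =ᵐ[pairMeasure Ω δ] pairDiff v := by
  filter_upwards [Measure.quasiMeasurePreserving_snd.ae_eq_comp huv,
    Measure.quasiMeasurePreserving_fst.ae_eq_comp huv] with z h1 h2
  simp only [Function.comp] at h1 h2
  simp only [pairDiff, h1, h2]

theorem ae_pairMeasure_of_ae {P : Euc N → Prop}
    (hP : ∀ᵐ x ∂volume.restrict (enlarged Ω δ), P x) :
    ∀ᵐ z ∂pairMeasure Ω δ, P z.1 ∧ P z.2 :=
  (Measure.quasiMeasurePreserving_fst.ae hP).and (Measure.quasiMeasurePreserving_snd.ae hP)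

theorem interactionMeasure_absolutelyContinuous :
    interactionMeasure Ω δ k p a ≪ pairMeasure Ω δ :=
  withDensity_absolutelyContinuous _ _

/-- Measurability is known only for `z ↦ k ‖z‖`, through integrability; it passes to pairs because
subtraction is quasi-measure-preserving. -/
theorem IsKernel.aemeasurable_pair (hk : IsKernel N p s c₀ δ k) :
    AEMeasurable (fun z : Euc N × Euc N => k ‖z.2 - z.1‖) (pairMeasure Ω δ) := by
  have h1 : Integrable (fun z : Euc N => k ‖z‖) :=
    (integrableOn_iff_integrable_of_support_subset hk.support_subset).1 hk.integrableOn
  have h2 := h1.1.aemeasurable.comp_quasiMeasurePreserving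
    (quasiMeasurePreserving_sub_of_right_invariant (volume : Measure (Euc N)) volume)
  have h3 : AEMeasurable (fun z : Euc N × Euc N => k ‖z.2 - z.1‖)
      ((volume : Measure (Euc N)).prod volume) := by
    simpa only [Function.comp_def, norm_sub_rev] using h2
  rw [pairMeasure, Measure.prod_restrict]
  exact h3.restrict

theorem IsKernel.aemeasurable_interactionWeight (hk : IsKernel N p s c₀ δ k)
    (ha : AEMeasurable (fun z : Euc N × Euc N => a z.2 z.1) (pairMeasure Ω δ)) :
    AEMeasurable (interactionWeight a k p) (pairMeasure Ω δ) := by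
  have h1 := hk.aemeasurable_pair (Ω := Ω)
  have h2 : AEMeasurable (fun z : Euc N × Euc N => ‖z.2 - z.1‖ ^ p) (pairMeasure Ω δ) := by
    fun_prop
  exact ha.mul (h1.div h2)

theorem IsKernel.interactionWeight_nonneg (hk : IsKernel N p s c₀ δ k) {z : Euc N × Euc N}
    (ha : 0 ≤ a z.2 z.1) : 0 ≤ interactionWeight a k p z :=
  mul_nonneg ha (div_nonneg (hk.nonneg _ (norm_nonneg _)) (by positivity))

theorem enorm_rpow_eq_ofReal (hp : 1 < p) (x : ℝ) : ‖x‖ₑ ^ p = ENNReal.ofReal (|x| ^ p) := by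
  rw [← ENNReal.ofReal_rpow_of_nonneg (abs_nonneg x) (by linarith), Real.enorm_eq_ofReal_abs]

theorem IsKernel.energy_eq (hk : IsKernel N p s c₀ δ k) (hp : 1 < p)
    (hu : AEMeasurable u (volume.restrict (enlarged Ω δ))) :
    energy Ω δ k p u = ∫⁻ z, ENNReal.ofReal (interactionWeight (fun _ _ => 1) k p z) *
      ‖pairDiff u z‖ₑ ^ p ∂pairMeasure Ω δ := by
  have hw := hk.aemeasurable_interactionWeight (Ω := Ω) (a := fun _ _ => 1) aemeasurable_const
  have hd := aemeasurable_pairDiff hu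
  rw [pairMeasure, lintegral_prod _ (by
    exact hw.ennreal_ofReal.mul (hd.enorm.pow_const p))]
  refine lintegral_congr fun x => lintegral_congr fun x' => ?_
  rw [formIntegrand_eq_weight_mul _ k p u u (x, x'),
    ENNReal.ofReal_mul (hk.interactionWeight_nonneg zero_le_one),
    abs_rpow_sub_two_mul_sq hp, enorm_rpow_eq_ofReal hp]

theorem memLp_pairDiff_iff (hp : 1 < p) (hk : IsKernel N p s c₀ δ k)
    (ha : AEMeasurable (fun z : Euc N × Euc N => a z.2 z.1) (pairMeasure Ω δ))
    (hu : AEMeasurable u (volume.restrict (enlarged Ω δ))) :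
    MemLp (pairDiff u) (ENNReal.ofReal p) (interactionMeasure Ω δ k p a) ↔
      ∫⁻ z, ENNReal.ofReal (interactionWeight a k p z) * ‖pairDiff u z‖ₑ ^ p
        ∂pairMeasure Ω δ < ⊤ := by
  have hp0 : 0 < p := by linarith
  have hd := aemeasurable_pairDiff hu
  have hw := hk.aemeasurable_interactionWeight ha
  have hm : AEStronglyMeasurable (pairDiff u) (interactionMeasure Ω δ k p a) :=
    (hd.mono_ac interactionMeasure_absolutelyContinuous).aestronglyMeasurable
  rw [MemLp, and_iff_right hm, eLpNorm_lt_top_iff_lintegral_rpow_enorm_lt_top (by simpa using hp0)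
    ENNReal.ofReal_ne_top, ENNReal.toReal_ofReal hp0.le, interactionMeasure,
    lintegral_withDensity_eq_lintegral_mul₀ hw.ennreal_ofReal (hd.enorm.pow_const p)]
  rfl

theorem energy_lt_top_iff_memLp (hp : 1 < p) (hk : IsKernel N p s c₀ δ k)
    (hu : AEMeasurable u (volume.restrict (enlarged Ω δ))) :
    energy Ω δ k p u < ⊤ ↔
      MemLp (pairDiff u) (ENNReal.ofReal p) (interactionMeasure Ω δ k p fun _ _ => 1) := by
  rw [hk.energy_eq hp hu, memLp_pairDiff_iff hp hk aemeasurable_const hu]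

theorem integral_interactionMeasure (hk : IsKernel N p s c₀ δ k)
    (ha : AEMeasurable (fun z : Euc N × Euc N => a z.2 z.1) (pairMeasure Ω δ))
    (ha0 : ∀ᵐ z ∂pairMeasure Ω δ, 0 ≤ a z.2 z.1) {F : Euc N × Euc N → ℝ}
    (hF : Integrable F (interactionMeasure Ω δ k p a)) :
    ∫ z, F z ∂interactionMeasure Ω δ k p a =
      ∫ x in enlarged Ω δ, ∫ x' in enlarged Ω δ,
        interactionWeight a k p (x, x') * F (x, x') := by
  have hw := hk.aemeasurable_interactionWeight ha
  have hae : (fun z => (ENNReal.ofReal (interactionWeight a k p z)).toReal • F z)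
      =ᵐ[pairMeasure Ω δ] fun z => interactionWeight a k p z * F z := by
    filter_upwards [ha0] with z hz
    rw [ENNReal.toReal_ofReal (hk.interactionWeight_nonneg hz), smul_eq_mul]
  have hlt : ∀ᵐ z ∂pairMeasure Ω δ, ENNReal.ofReal (interactionWeight a k p z) < ⊤ :=
    Filter.Eventually.of_forall fun _ => ENNReal.ofReal_lt_top
  rw [interactionMeasure, integrable_withDensity_iff_integrable_smul₀' hw.ennreal_ofReal hlt,
    integrable_congr hae] at hF
  rw [interactionMeasure, integral_withDensity_eq_integral_toReal_smul₀ hw.ennreal_ofReal hlt,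
    integral_congr_ae hae]
  exact integral_prod _ hF

theorem IsCoefficient.ae_mem (hh : IsCoefficient Ω δ hmin hmax h) (hΩ : IsOpen Ω)
    (hmin_pos : 0 < hmin) (hlt : hmin < hmax) :
    ∀ᵐ x ∂volume.restrict (enlarged Ω δ), 0 ≤ h x ∧ h x ≤ hmax ∧ (x ∈ Ω → hmin ≤ h x) := by
  have h1 := (ae_restrict_iff' hΩ.measurableSet).1 hh.mem_Icc
  have h2 := (ae_restrict_iff' ((isOpen_enlarged hΩ δ).measurableSet.diff hΩ.measurableSet)).1
    hh.eq_zero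
  refine (ae_restrict_iff' (isOpen_enlarged hΩ δ).measurableSet).2 ?_
  filter_upwards [h1, h2] with x h1 h2 hx
  by_cases hxΩ : x ∈ Ω
  · obtain ⟨h3, h4⟩ := h1 hxΩ
    exact ⟨by linarith, h4, fun _ => h3⟩
  · rw [h2 ⟨hx, hxΩ⟩]
    exact ⟨le_rfl, by linarith, fun h => absurd h hxΩ⟩

theorem IsCoefficient.aemeasurable_average (hh : IsCoefficient Ω δ hmin hmax h) :
    AEMeasurable (fun z : Euc N × Euc N => (h z.2 + h z.1) / 2) (pairMeasure Ω δ) :=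
  ((hh.aemeasurable.comp_quasiMeasurePreserving Measure.quasiMeasurePreserving_snd).add
    (hh.aemeasurable.comp_quasiMeasurePreserving Measure.quasiMeasurePreserving_fst)).div_const 2

theorem weightedForm_eq_integral (hp : 1 < p) (hk : IsKernel N p s c₀ δ k)
    (hh : IsCoefficient Ω δ hmin hmax h) (hΩ : IsOpen Ω) (hmin_pos : 0 < hmin)
    (hlt : hmin < hmax)
    (hu : MemLp (pairDiff u) (ENNReal.ofReal p)
      (interactionMeasure Ω δ k p fun y' y => (h y' + h y) / 2))
    (hv : MemLp (pairDiff v) (ENNReal.ofReal p)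
      (interactionMeasure Ω δ k p fun y' y => (h y' + h y) / 2)) :
    weightedForm Ω δ k p h u v = ∫ z, |pairDiff u z| ^ (p - 2) * pairDiff u z * pairDiff v z
      ∂interactionMeasure Ω δ k p fun y' y => (h y' + h y) / 2 := by
  rw [integral_interactionMeasure hk hh.aemeasurable_average ?_
    (hu.integrable_abs_rpow_sub_two_mul hp hv)]
  · refine integral_congr_ae (Filter.Eventually.of_forall fun x => ?_)
    refine integral_congr_ae (Filter.Eventually.of_forall fun x' => ?_)
    exact formIntegrand_eq_weight_mul _ k p u v (x, x')
  · filter_upwards [ae_pairMeasure_of_ae (hh.ae_mem hΩ hmin_pos hlt)] with z hz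
    linarith [hz.1.1, hz.2.1]

/-- The bound `H ≤ hmax` a.e. dominates the weighted measure by `hmax` times the unweighted one. -/
theorem MeasureTheory.MemLp.pairDiff_weighted (hk : IsKernel N p s c₀ δ k)
    (hh : IsCoefficient Ω δ hmin hmax h) (hΩ : IsOpen Ω) (hmin_pos : 0 < hmin)
    (hlt : hmin < hmax) {F : Euc N × Euc N → ℝ}
    (hF : MemLp F (ENNReal.ofReal p) (interactionMeasure Ω δ k p fun _ _ => 1)) :
    MemLp F (ENNReal.ofReal p)
      (interactionMeasure Ω δ k p fun y' y => (h y' + h y) / 2) := by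
  refine hF.of_measure_le_smul (c := ENNReal.ofReal hmax) ENNReal.ofReal_ne_top ?_
  have hw := hk.aemeasurable_interactionWeight (Ω := Ω) (a := fun _ _ => 1) aemeasurable_const
  rw [interactionMeasure, interactionMeasure, ← withDensity_smul' _ _ ENNReal.ofReal_ne_top]
  refine withDensity_mono ?_
  filter_upwards [ae_pairMeasure_of_ae (hh.ae_mem hΩ hmin_pos hlt)] with z hz
  rw [Pi.smul_apply, smul_eq_mul, ← ENNReal.ofReal_mul (by linarith)]
  refine ENNReal.ofReal_le_ofReal ?_
  have h0 : 0 ≤ k ‖z.2 - z.1‖ / ‖z.2 - z.1‖ ^ p :=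
    div_nonneg (hk.nonneg _ (norm_nonneg _)) (by positivity)
  simp only [interactionWeight, one_mul]
  exact mul_le_mul_of_nonneg_right (by linarith [hz.1.2.1, hz.2.2.1]) h0

theorem ae_eq_zero_of_notMem (hΩ : IsOpen Ω)
    (hu0 : ∀ᵐ x ∂volume.restrict (enlarged Ω δ \ Ω), u x = 0) :
    ∀ᵐ x ∂volume.restrict (enlarged Ω δ), x ∉ Ω → u x = 0 := by
  rw [ae_restrict_iff' ((isOpen_enlarged hΩ δ).measurableSet.diff hΩ.measurableSet)] at hu0
  rw [ae_restrict_iff' (isOpen_enlarged hΩ δ).measurableSet]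
  filter_upwards [hu0] with x hx h1 h2 using hx ⟨h1, h2⟩

/-- If both points lie outside `Ω`, the difference of `u` is zero; otherwise one value of `h` is at
least `hmin` and the other is nonnegative, so `H ≥ hmin / 2`. -/
theorem lintegral_energy_le_weighted (hp : 1 < p) (hk : IsKernel N p s c₀ δ k)
    (hh : IsCoefficient Ω δ hmin hmax h) (hΩ : IsOpen Ω) (hmin_pos : 0 < hmin)
    (hlt : hmin < hmax) (hu0 : ∀ᵐ x ∂volume.restrict (enlarged Ω δ \ Ω), u x = 0) :
    ∫⁻ z, ENNReal.ofReal (interactionWeight (fun _ _ => 1) k p z) * ‖pairDiff u z‖ₑ ^ p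
        ∂pairMeasure Ω δ ≤
      ENNReal.ofReal (2 / hmin) *
        ∫⁻ z, ENNReal.ofReal (interactionWeight (fun y' y => (h y' + h y) / 2) k p z) *
          ‖pairDiff u z‖ₑ ^ p ∂pairMeasure Ω δ := by
  rw [← lintegral_const_mul' _ _ ENNReal.ofReal_ne_top]
  refine lintegral_mono_ae ?_
  filter_upwards [ae_pairMeasure_of_ae (hh.ae_mem hΩ hmin_pos hlt),
    ae_pairMeasure_of_ae (ae_eq_zero_of_notMem hΩ hu0)] with z hz hz0
  by_cases hz' : z.1 ∉ Ω ∧ z.2 ∉ Ω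
  · have : pairDiff u z = 0 := by simp [pairDiff, hz0.1 hz'.1, hz0.2 hz'.2]
    simp [this, show 0 < p by linarith]
  · rw [← mul_assoc, ← ENNReal.ofReal_mul (by positivity)]
    gcongr
    have h0 : 0 ≤ k ‖z.2 - z.1‖ / ‖z.2 - z.1‖ ^ p :=
      div_nonneg (hk.nonneg _ (norm_nonneg _)) (by positivity)
    simp only [interactionWeight]
    rw [← mul_assoc]
    refine mul_le_mul_of_nonneg_right ?_ h0
    have h2 : hmin ≤ h z.2 + h z.1 := by
      by_cases h1 : z.1 ∈ Ω
      · linarith [hz.1.2.2 h1, hz.2.1]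
      · have : z.2 ∈ Ω := by
          by_contra h2
          exact hz' ⟨h1, h2⟩
        linarith [hz.2.2.2 this, hz.1.1]
    rw [div_mul_div_comm, le_div_iff₀ (by positivity)]
    linarith

end Pairs

/-! ### A nonlocal Poincaré inequality by iterated translation. -/

section Poincare

variable {N : ℕ} {Ω : Set (Euc N)} {δ p s c₀ : ℝ} {k : ℝ → ℝ}

/-- For `y` outside `Ω`, the distance to `Ω` is attained at a boundary point and is at most `dist y
x`. Thus pairs at distance less than `δ` with one point in `Ω` are all seen by the energy. -/
theorem mem_enlarged_of_dist_lt {x y : Euc N} (hx : x ∈ Ω) (hxy : dist y x < δ) :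
    y ∈ enlarged Ω δ := by
  by_cases hy : y ∈ Ω
  · exact Or.inl hy
  · obtain ⟨q, hq, hqd⟩ := exists_mem_frontier_infDist_compl_eq_dist (s := Ωᶜ) (x := y) hy
      (fun h => (h.symm ▸ mem_univ x : x ∈ Ωᶜ) hx)
    rw [compl_compl] at hqd
    rw [frontier_compl] at hq
    refine Or.inr (mem_iUnion₂.2 ⟨q, hq, ?_⟩)
    rw [Metric.mem_ball, ← hqd]
    exact (Metric.infDist_le_dist_of_mem hx).trans_lt hxy

/-- Telescoping into `m` single shifts, which all have the same norm by translation invariance. -/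
theorem eLpNorm_translate_sub_le {q : ENNReal} (hq : 1 ≤ q) {w : Euc N → ℝ} (hw : Measurable w)
    (z : Euc N) (m : ℕ) :
    eLpNorm (fun x => w (x + m • z) - w x) q volume ≤
      m * eLpNorm (fun x => w (x + z) - w x) q volume := by
  induction m with
  | zero => simp
  | succ m ih =>
    have h1 : (fun x => w (x + (m + 1) • z) - w x) =
        (fun x => w (x + m • z + z) - w (x + m • z)) + fun x => w (x + m • z) - w x := by
      funext x
      simp only [Pi.add_apply, add_smul, one_smul, add_assoc]
      ring
    have h2 : eLpNorm (fun x => w (x + m • z + z) - w (x + m • z)) q volume =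
        eLpNorm (fun x => w (x + z) - w x) q volume :=
      eLpNorm_comp_measurePreserving (g := fun x => w (x + z) - w x)
        (by fun_prop : Measurable fun x => w (x + z) - w x).aestronglyMeasurable
        (measurePreserving_add_right volume (m • z))
    rw [h1]
    refine (eLpNorm_add_le (by fun_prop : Measurable _).aestronglyMeasurable
      (by fun_prop : Measurable _).aestronglyMeasurable hq).trans ?_
    rw [h2]
    push_cast
    rw [add_mul, one_mul, add_comm]
    gcongr

/-- A shift by `m • z` of length at least `2 * R` carries every point of `Ω` out of `Ω`, so there
`|w|` equals the modulus of the `m`-step difference. -/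
theorem lintegral_rpow_le_translate (hp : 1 < p) {R : ℝ} (hR : Ω ⊆ Metric.ball 0 R)
    {w : Euc N → ℝ} (hw : Measurable w) (hw0 : ∀ x ∉ Ω, w x = 0) {z : Euc N} {m : ℕ}
    (hm : 2 * R ≤ m * ‖z‖) :
    ∫⁻ x, ‖w x‖ₑ ^ p ≤ (m : ENNReal) ^ p * ∫⁻ x, ‖w (x + z) - w x‖ₑ ^ p := by
  have hp0 : 0 < p := by linarith
  have hq0 : ENNReal.ofReal p ≠ 0 := by simpa using hp0
  have h1 : eLpNorm w (ENNReal.ofReal p) volume ≤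
      eLpNorm (fun x => w (x + m • z) - w x) (ENNReal.ofReal p) volume := by
    refine eLpNorm_mono fun x => ?_
    by_cases hx : x ∈ Ω
    · have hx' : x + m • z ∉ Ω := fun hx' => by
        have h2 := mem_ball_zero_iff.1 (hR hx)
        have h3 := mem_ball_zero_iff.1 (hR hx')
        have h4 : ‖m • z‖ ≤ ‖x + m • z‖ + ‖x‖ := by
          simpa using norm_sub_le (x + m • z) x
        rw [← Nat.cast_smul_eq_nsmul ℝ, norm_smul, Real.norm_natCast,
          Nat.cast_smul_eq_nsmul ℝ] at h4
        linarith
      simp [hw0 _ hx']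
    · simp [hw0 _ hx]
  have h2 := h1.trans (eLpNorm_translate_sub_le (by simpa using hp.le) hw z m)
  have h3 := ENNReal.rpow_le_rpow h2 hp0.le
  rw [ENNReal.mul_rpow_of_nonneg _ _ hp0.le,
    eLpNorm_eq_lintegral_rpow_enorm_toReal hq0 ENNReal.ofReal_ne_top,
    eLpNorm_eq_lintegral_rpow_enorm_toReal hq0 ENNReal.ofReal_ne_top,
    ENNReal.toReal_ofReal hp0.le, ← ENNReal.rpow_mul, ← ENNReal.rpow_mul,
    one_div_mul_cancel hp0.ne', ENNReal.rpow_one, ENNReal.rpow_one] at h3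
  exact h3

/-- Dividing the lower bound on `k` by `r ^ p` gives the density `c₀ / r ^ (N + s p)`, which is
smallest at `r = δ`. -/
theorem IsKernel.one_le_mul_weight (hk : IsKernel N p s c₀ δ k) (hc₀ : 0 < c₀) (hp : 1 < p)
    (hs : 0 < s) {z : Euc N × Euc N} (hz : z.2 ≠ z.1) (hzδ : ‖z.2 - z.1‖ < δ) :
    1 ≤ ENNReal.ofReal (δ ^ ((N : ℝ) + s * p) / c₀) *
      ENNReal.ofReal (interactionWeight (fun _ _ => 1) k p z) := by
  have hr : 0 < ‖z.2 - z.1‖ := norm_pos_iff.2 (sub_ne_zero.2 hz)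
  have hδ : 0 < δ := hr.trans hzδ
  rw [← ENNReal.ofReal_mul (by positivity), ENNReal.one_le_ofReal]
  have h1 := hk.lower_bound _ (sub_ne_zero.2 hz) hzδ
  simp only [interactionWeight, one_mul]
  set r := ‖z.2 - z.1‖
  have h2 : c₀ / r ^ ((N : ℝ) + s * p) ≤ k r / r ^ p := by
    have h3 : r ^ ((N : ℝ) + s * p) = r ^ ((N : ℝ) + (s - 1) * p) * r ^ p := by
      rw [← Real.rpow_add hr]; ring_nf
    rw [h3, ← div_div]
    exact div_le_div_of_nonneg_right h1 (by positivity)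
  have hsp : 0 < s * p := mul_pos hs (by linarith)
  have h4 : r ^ ((N : ℝ) + s * p) ≤ δ ^ ((N : ℝ) + s * p) :=
    Real.rpow_le_rpow hr.le hzδ.le (by positivity)
  calc (1 : ℝ) = δ ^ ((N : ℝ) + s * p) / c₀ * (c₀ / δ ^ ((N : ℝ) + s * p)) := by
        field_simp
    _ ≤ δ ^ ((N : ℝ) + s * p) / c₀ * (k r / r ^ p) := by
        refine mul_le_mul_of_nonneg_left (le_trans ?_ h2) (by positivity)
        gcongr

theorem exists_poincare_measurable (hp : 1 < p) (hs : 0 < s) (hc₀ : 0 < c₀) (hδ : 0 < δ)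
    (hN : 0 < N) (hΩ : IsOpen Ω) (hΩb : Bornology.IsBounded Ω) (hk : IsKernel N p s c₀ δ k) :
    ∃ C : ENNReal, C ≠ ⊤ ∧ ∀ w : Euc N → ℝ, Measurable w → (∀ x ∉ Ω, w x = 0) →
      ∫⁻ x, ‖w x‖ₑ ^ p ≤ C * ∫⁻ z, ENNReal.ofReal (interactionWeight (fun _ _ => 1) k p z) *
        ‖pairDiff w z‖ₑ ^ p ∂pairMeasure Ω δ := by
  have hp0 : 0 < p := by linarith
  have : Nonempty (Fin N) := ⟨⟨0, hN⟩⟩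
  obtain ⟨R, hR⟩ := hΩb.subset_ball 0
  obtain ⟨m, hm⟩ := exists_nat_ge (2 * R / (δ / 2))
  rw [div_le_iff₀ (by positivity)] at hm
  -- Shifts in this annulus are short enough for the kernel bound and long enough for one `m` to
  -- serve them all. The translation estimate is integrated over `A`, which has positive finite
  -- measure.
  set A : Set (Euc N) := {z | δ / 2 < ‖z‖ ∧ ‖z‖ < δ} with hA
  have hAo : IsOpen A :=
    (isOpen_lt continuous_const continuous_norm).inter (isOpen_lt continuous_norm continuous_const)
  have hA0 : volume A ≠ 0 := by
    obtain ⟨z, hz⟩ := exists_norm_eq (Euc N) (show (0 : ℝ) ≤ 3 / 4 * δ by positivity)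
    exact (hAo.measure_pos volume ⟨z, by rw [hA]; constructor <;> rw [hz] <;> linarith⟩).ne'
  have hAtop : volume A ≠ ⊤ :=
    (measure_mono_top (fun z hz => mem_ball_zero_iff.2 hz.2 : A ⊆ Metric.ball 0 δ)).mt
      measure_ball_lt_top.ne
  set K := ENNReal.ofReal (δ ^ ((N : ℝ) + s * p) / c₀) with hK
  refine ⟨(volume A)⁻¹ * ((m : ENNReal) ^ p * K), ?_, fun w hw hw0 => ?_⟩
  · refine ENNReal.mul_ne_top (ENNReal.inv_ne_top.2 hA0) (ENNReal.mul_ne_top ?_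
      ENNReal.ofReal_ne_top)
    exact ENNReal.rpow_ne_top_of_nonneg hp0.le (ENNReal.natCast_ne_top m)
  set I := ∫⁻ x, ‖w x‖ₑ ^ p
  set G := fun z : Euc N × Euc N => ENNReal.ofReal (interactionWeight (fun _ _ => 1) k p z) *
        ‖pairDiff w z‖ₑ ^ p
  set F := fun z : Euc N × Euc N => A.indicator (1 : Euc N → ENNReal) (z.2 - z.1) *
    ‖w z.2 - w z.1‖ₑ ^ p with hF
  have hind : Measurable (A.indicator (1 : Euc N → ENNReal)) :=
    measurable_one.indicator hAo.measurableSet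
  have hFm : Measurable F := by fun_prop
  -- `F` vanishes unless a point of the pair lies in `Ω` and the distance is below `δ`; then both
  -- points lie in the enlarged domain.
  have hFG : ∫⁻ z, F z ∂((volume : Measure (Euc N)).prod volume) ≤
      K * ∫⁻ z, G z ∂pairMeasure Ω δ := by
    have hS : MeasurableSet (enlarged Ω δ ×ˢ enlarged Ω δ) :=
      (isOpen_enlarged hΩ δ).measurableSet.prod (isOpen_enlarged hΩ δ).measurableSet
    rw [← lintegral_const_mul' _ _ ENNReal.ofReal_ne_top, pairMeasure, Measure.prod_restrict,
      ← lintegral_indicator hS]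
    refine lintegral_mono fun z => ?_
    by_cases hzA : z.2 - z.1 ∈ A
    · by_cases hz : z.1 ∉ Ω ∧ z.2 ∉ Ω
      · simp [hF, hw0 _ hz.1, hw0 _ hz.2, hp0]
      · have hzS : z ∈ enlarged Ω δ ×ˢ enlarged Ω δ := by
          have hd : dist z.2 z.1 < δ := by rw [dist_eq_norm]; exact hzA.2
          by_cases h1 : z.1 ∈ Ω
          · exact ⟨subset_enlarged Ω δ h1, mem_enlarged_of_dist_lt h1 hd⟩
          · have h2 : z.2 ∈ Ω := by
              by_contra h2
              exact hz ⟨h1, h2⟩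
            exact ⟨mem_enlarged_of_dist_lt h2 (by rwa [dist_comm]), subset_enlarged Ω δ h2⟩
        have hne : z.2 ≠ z.1 := fun h => by
          have := hzA.1
          rw [h, sub_self, norm_zero] at this
          linarith
        rw [indicator_of_mem hzS]
        simp only [hF, G, indicator_of_mem hzA, Pi.one_apply]
        rw [← mul_assoc]
        exact mul_le_mul_left (hk.one_le_mul_weight hc₀ hp hs hne hzA.2) _
    · simp [hF, indicator_of_notMem hzA]
  have hAI : volume A * I ≤
      (m : ENNReal) ^ p * ∫⁻ z, F z ∂((volume : Measure (Euc N)).prod volume) := by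
    calc volume A * I = ∫⁻ _ in A, I := by rw [setLIntegral_const, mul_comm]
      _ ≤ ∫⁻ z in A, (m : ENNReal) ^ p * ∫⁻ x, ‖w (x + z) - w x‖ₑ ^ p := by
          refine setLIntegral_mono' hAo.measurableSet fun z hz => ?_
          refine lintegral_rpow_le_translate hp hR hw hw0 (hm.trans ?_)
          exact mul_le_mul_of_nonneg_left hz.1.le (by positivity)
      _ = (m : ENNReal) ^ p * ∫⁻ z in A, ∫⁻ x, ‖w (x + z) - w x‖ₑ ^ p := by
          rw [lintegral_const_mul']
          exact ENNReal.rpow_ne_top_of_nonneg hp0.le (ENNReal.natCast_ne_top m)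
      _ = (m : ENNReal) ^ p * ∫⁻ z, ∫⁻ x, F (x, x + z) := by
          rw [← lintegral_indicator hAo.measurableSet]
          congr 1
          refine lintegral_congr fun z => ?_
          by_cases hz : z ∈ A <;> simp [hF, hz]
      _ = (m : ENNReal) ^ p * ∫⁻ x, ∫⁻ z, F (x, x + z) := by
          rw [lintegral_lintegral_swap]
          exact (by fun_prop : Measurable _).aemeasurable
      _ = (m : ENNReal) ^ p * ∫⁻ x, ∫⁻ z, F (x, z) := by
          congr 1
          exact lintegral_congr fun x => lintegral_add_left_eq_self (fun y => F (x, y)) x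
      _ = _ := by rw [lintegral_prod _ hFm.aemeasurable]
  calc I = (volume A)⁻¹ * (volume A * I) := by
        rw [← mul_assoc, ENNReal.inv_mul_cancel hA0 hAtop, one_mul]
    _ ≤ (volume A)⁻¹ * ((m : ENNReal) ^ p * (K * ∫⁻ z, G z ∂pairMeasure Ω δ)) := by
        exact mul_le_mul_right (hAI.trans (mul_le_mul_right hFG _)) _
    _ = _ := by ring

/-- Poincaré inequality for functions vanishing outside `Ω`. -/
theorem exists_poincare (hp : 1 < p) (hs : 0 < s) (hc₀ : 0 < c₀) (hδ : 0 < δ)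
    (hN : 0 < N) (hΩ : IsOpen Ω) (hΩb : Bornology.IsBounded Ω) (hk : IsKernel N p s c₀ δ k) :
    ∃ C : ENNReal, C ≠ ⊤ ∧ ∀ u : Euc N → ℝ, AEMeasurable u (volume.restrict (enlarged Ω δ)) →
      (∀ᵐ x ∂volume.restrict (enlarged Ω δ \ Ω), u x = 0) →
      ∫⁻ x in enlarged Ω δ, ‖u x‖ₑ ^ p ≤
        C * ∫⁻ z, ENNReal.ofReal (interactionWeight (fun _ _ => 1) k p z) *
          ‖pairDiff u z‖ₑ ^ p ∂pairMeasure Ω δ := by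
  obtain ⟨C, hC, h⟩ := exists_poincare_measurable hp hs hc₀ hδ hN hΩ hΩb hk
  refine ⟨C, hC, fun u hu hu0 => ?_⟩
  -- A representative that is measurable on the whole space and vanishes everywhere outside `Ω`.
  set w := Ω.indicator (hu.mk u) with hw
  have huw : u =ᵐ[volume.restrict (enlarged Ω δ)] w := by
    filter_upwards [hu.ae_eq_mk, ae_eq_zero_of_notMem hΩ hu0] with x h1 h2
    by_cases hx : x ∈ Ω
    · rw [hw, indicator_of_mem hx, h1]
    · rw [hw, indicator_of_notMem hx, h2 hx]
  have h1 := h w (hu.measurable_mk.indicator hΩ.measurableSet)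
    fun x hx => indicator_of_notMem hx _
  calc ∫⁻ x in enlarged Ω δ, ‖u x‖ₑ ^ p = ∫⁻ x in enlarged Ω δ, ‖w x‖ₑ ^ p :=
        lintegral_congr_ae (huw.mono fun x hx => by simp only [hx])
    _ ≤ ∫⁻ x, ‖w x‖ₑ ^ p := setLIntegral_le_lintegral _ _
    _ ≤ _ := h1
    _ = _ := by
        congr 1
        exact lintegral_congr_ae ((pairDiff_congr huw).mono fun z hz => by simp only [hz])

end Poincare

/-! ### The energy spaces, the difference operator and the source functional. -/

/-- The standing assumptions of the nonlocal Dirichlet problem. -/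
structure DirichletSetting {N : ℕ} (p s c₀ δ hmin hmax : ℝ) (Ω : Set (Euc N)) (k : ℝ → ℝ)
    (h : Euc N → ℝ) : Prop where
  one_lt : 1 < p
  s_pos : 0 < s
  c₀_pos : 0 < c₀
  δ_pos : 0 < δ
  hmin_pos : 0 < hmin
  hmin_lt : hmin < hmax
  dim_pos : 0 < N
  isOpen : IsOpen Ω
  isBounded : Bornology.IsBounded Ω
  isKernel : IsKernel N p s c₀ δ k
  isCoefficient : IsCoefficient Ω δ hmin hmax h

namespace DirichletSetting

variable {N : ℕ} {p s c₀ δ hmin hmax : ℝ} {Ω : Set (Euc N)} {k : ℝ → ℝ} {h g u₀ : Euc N → ℝ}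

theorem aemeasurable_coe (u : LpEnlarged Ω δ p) :
    AEMeasurable u (volume.restrict (enlarged Ω δ)) :=
  (Lp.aestronglyMeasurable u).aemeasurable

theorem pairDiff_coe_add (u v : LpEnlarged Ω δ p) :
    pairDiff (u + v : LpEnlarged Ω δ p) =ᵐ[pairMeasure Ω δ] pairDiff u + pairDiff v := by
  filter_upwards [pairDiff_congr (Lp.coeFn_add u v)] with z hz
  rw [hz]
  simp only [pairDiff, Pi.add_apply]
  ring

theorem pairDiff_coe_smul (c : ℝ) (u : LpEnlarged Ω δ p) :
    pairDiff (c • u : LpEnlarged Ω δ p) =ᵐ[pairMeasure Ω δ] c • pairDiff u := by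
  filter_upwards [pairDiff_congr (Lp.coeFn_smul c u)] with z hz
  rw [hz]
  simp only [pairDiff, Pi.smul_apply, smul_eq_mul]
  ring

theorem mem_energySpace_iff (D : DirichletSetting p s c₀ δ hmin hmax Ω k h)
    {u : LpEnlarged Ω δ p} : u ∈ energySpace Ω δ k p ↔
      MemLp (pairDiff u) (ENNReal.ofReal p) (interactionMeasure Ω δ k p fun _ _ => 1) :=
  energy_lt_top_iff_memLp D.one_lt D.isKernel (aemeasurable_coe u)

/-- The energy space as a submodule of `L^p`. -/
def energySubmodule (D : DirichletSetting p s c₀ δ hmin hmax Ω k h) :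
    Submodule ℝ (LpEnlarged Ω δ p) where
  carrier := energySpace Ω δ k p
  add_mem' {u v} hu hv := by
    rw [D.mem_energySpace_iff] at hu hv ⊢
    exact (hu.add hv).ae_eq
      (interactionMeasure_absolutelyContinuous.ae_eq (pairDiff_coe_add u v)).symm
  zero_mem' := by
    rw [D.mem_energySpace_iff]
    refine (MemLp.zero (ε := ℝ)).ae_eq
      (interactionMeasure_absolutelyContinuous.ae_eq ?_).symm
    filter_upwards [pairDiff_congr (Lp.coeFn_zero ℝ (ENNReal.ofReal p)
      (volume.restrict (enlarged Ω δ)))] with z hz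
    rw [hz]
    simp [pairDiff]
  smul_mem' c u hu := by
    rw [D.mem_energySpace_iff] at hu ⊢
    exact (hu.const_smul c).ae_eq
      (interactionMeasure_absolutelyContinuous.ae_eq (pairDiff_coe_smul c u)).symm

/-- The elements of the energy space that vanish outside `Ω`, as a submodule. -/
def energyZeroSubmodule (D : DirichletSetting p s c₀ δ hmin hmax Ω k h) :
    Submodule ℝ D.energySubmodule where
  carrier := {u | ∀ᵐ x ∂(volume.restrict (enlarged Ω δ \ Ω)), u.1 x = 0}
  add_mem' {u v} hu hv := by
    filter_upwards [hu, hv,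
      ae_restrict_of_ae_restrict_of_subset sdiff_subset (Lp.coeFn_add u.1 v.1)] with x h1 h2 h3
    rw [Submodule.coe_add, h3, Pi.add_apply, h1, h2, add_zero]
  zero_mem' := by
    filter_upwards [ae_restrict_of_ae_restrict_of_subset sdiff_subset
      (Lp.coeFn_zero ℝ (ENNReal.ofReal p) (volume.restrict (enlarged Ω δ)))] with x h1
    rw [Submodule.coe_zero, h1, Pi.zero_apply]
  smul_mem' c u hu := by
    filter_upwards [hu,
      ae_restrict_of_ae_restrict_of_subset sdiff_subset (Lp.coeFn_smul c u.1)] with x h1 h2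
    rw [Submodule.coe_smul, h2, Pi.smul_apply, h1, smul_zero]

theorem memLp_pairDiff (D : DirichletSetting p s c₀ δ hmin hmax Ω k h)
    (u : D.energySubmodule) : MemLp (pairDiff u.1) (ENNReal.ofReal p)
      (interactionMeasure Ω δ k p fun y' y => (h y' + h y) / 2) :=
  (D.mem_energySpace_iff.1 u.2).pairDiff_weighted D.isKernel D.isCoefficient D.isOpen D.hmin_pos
    D.hmin_lt

/-- The difference operator from the energy space to the weighted `L^p` space on pairs. -/
noncomputable def pairDiffLp (D : DirichletSetting p s c₀ δ hmin hmax Ω k h) :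
    D.energySubmodule →ₗ[ℝ] Lp ℝ (ENNReal.ofReal p)
      (interactionMeasure Ω δ k p fun y' y => (h y' + h y) / 2) where
  toFun u := (D.memLp_pairDiff u).toLp (pairDiff u.1)
  map_add' u v := by
    rw [← MemLp.toLp_add]
    exact MemLp.toLp_congr _ _
      (interactionMeasure_absolutelyContinuous.ae_eq (pairDiff_coe_add u.1 v.1))
  map_smul' c u := by
    rw [RingHom.id_apply, ← MemLp.toLp_const_smul]
    exact MemLp.toLp_congr _ _
      (interactionMeasure_absolutelyContinuous.ae_eq (pairDiff_coe_smul c u.1))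

theorem coeFn_pairDiffLp (D : DirichletSetting p s c₀ δ hmin hmax Ω k h)
    (u : D.energySubmodule) :
    D.pairDiffLp u =ᵐ[interactionMeasure Ω δ k p fun y' y => (h y' + h y) / 2] pairDiff u.1 :=
  MemLp.coeFn_toLp (D.memLp_pairDiff u)

theorem integral_abs_pairDiff (D : DirichletSetting p s c₀ δ hmin hmax Ω k h)
    (u : D.energySubmodule) :
    ∫ z, |pairDiff u.1 z| ^ p ∂interactionMeasure Ω δ k p (fun y' y => (h y' + h y) / 2) =
      ‖D.pairDiffLp u‖ ^ p := by
  rw [Lp.norm_rpow_eq_integral D.one_lt]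
  exact integral_congr_ae ((D.coeFn_pairDiffLp u).mono fun z hz => by simp only [hz])

theorem weightedForm_eq (D : DirichletSetting p s c₀ δ hmin hmax Ω k h)
    (u v : D.energySubmodule) : weightedForm Ω δ k p h u.1 v.1 =
      ∫ z, |pairDiff u.1 z| ^ (p - 2) * pairDiff u.1 z * pairDiff v.1 z
        ∂interactionMeasure Ω δ k p fun y' y => (h y' + h y) / 2 :=
  weightedForm_eq_integral D.one_lt D.isKernel D.isCoefficient D.isOpen D.hmin_pos D.hmin_lt
    (D.memLp_pairDiff u) (D.memLp_pairDiff v)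

theorem weightedForm_self (D : DirichletSetting p s c₀ δ hmin hmax Ω k h)
    (u : D.energySubmodule) : weightedForm Ω δ k p h u.1 u.1 =
      ∫ z, |pairDiff u.1 z| ^ p
        ∂interactionMeasure Ω δ k p fun y' y => (h y' + h y) / 2 := by
  simp only [D.weightedForm_eq, abs_rpow_sub_two_mul_sq D.one_lt]

theorem eLpNorm_rpow_eq {α : Type*} [MeasurableSpace α] {μ : Measure α} (hp : 1 < p)
    (f : α → ℝ) : eLpNorm f (ENNReal.ofReal p) μ ^ p = ∫⁻ x, ‖f x‖ₑ ^ p ∂μ := by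
  have hp0 : 0 < p := by linarith
  rw [eLpNorm_eq_lintegral_rpow_enorm_toReal (by simpa using hp0) ENNReal.ofReal_ne_top,
    ENNReal.toReal_ofReal hp0.le, ← ENNReal.rpow_mul, one_div_mul_cancel hp0.ne',
    ENNReal.rpow_one]

theorem exists_norm_le (D : DirichletSetting p s c₀ δ hmin hmax Ω k h) :
    ∃ C : ℝ, 0 ≤ C ∧ ∀ u ∈ D.energyZeroSubmodule, ‖u.1‖ ≤ C * ‖D.pairDiffLp u‖ := by
  have hp0 : 0 < p := by linarith [D.one_lt]
  obtain ⟨C, hC, hP⟩ := exists_poincare D.one_lt D.s_pos D.c₀_pos D.δ_pos D.dim_pos D.isOpen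
    D.isBounded D.isKernel
  set K := C * ENNReal.ofReal (2 / hmin) with hK
  have hKtop : K ≠ ⊤ := ENNReal.mul_ne_top hC ENNReal.ofReal_ne_top
  refine ⟨(K ^ (1 / p)).toReal, ENNReal.toReal_nonneg, fun u hu => ?_⟩
  have h1 := hP u.1 (aemeasurable_coe u.1) hu
  have h2 := lintegral_energy_le_weighted D.one_lt D.isKernel D.isCoefficient D.isOpen D.hmin_pos
    D.hmin_lt hu
  have hw := D.isKernel.aemeasurable_interactionWeight
    (a := fun y' y => (h y' + h y) / 2) D.isCoefficient.aemeasurable_average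
  have h3 : ∫⁻ z, ENNReal.ofReal (interactionWeight (fun y' y => (h y' + h y) / 2) k p z) *
      ‖pairDiff u.1 z‖ₑ ^ p ∂pairMeasure Ω δ =
      eLpNorm (pairDiff u.1) (ENNReal.ofReal p)
        (interactionMeasure Ω δ k p fun y' y => (h y' + h y) / 2) ^ p := by
    rw [eLpNorm_rpow_eq D.one_lt, interactionMeasure,
      lintegral_withDensity_eq_lintegral_mul₀ hw.ennreal_ofReal
        ((aemeasurable_pairDiff (aemeasurable_coe u.1)).enorm.pow_const p)]
    rfl
  rw [h3] at h2
  rw [← eLpNorm_rpow_eq D.one_lt] at h1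
  have h4 : eLpNorm u.1 (ENNReal.ofReal p) (volume.restrict (enlarged Ω δ)) ≤
      K ^ (1 / p) * eLpNorm (pairDiff u.1) (ENNReal.ofReal p)
        (interactionMeasure Ω δ k p fun y' y => (h y' + h y) / 2) := by
    rw [← ENNReal.rpow_le_rpow_iff hp0, ENNReal.mul_rpow_of_nonneg _ _ hp0.le,
      ← ENNReal.rpow_mul, one_div_mul_cancel hp0.ne', ENNReal.rpow_one, hK, mul_assoc]
    exact h1.trans (mul_le_mul_right h2 C)
  rw [Lp.norm_def, pairDiffLp, LinearMap.coe_mk, AddHom.coe_mk, Lp.norm_toLp,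
    ← ENNReal.toReal_mul]
  exact ENNReal.toReal_mono (ENNReal.mul_ne_top
    (ENNReal.rpow_ne_top_of_nonneg (by positivity) hKtop) (D.memLp_pairDiff u).eLpNorm_ne_top) h4

/-- By `exists_norm_le`, convergence of the differences forces convergence of the functions in
`L^p`. Along a common subsequence both converge a.e., which identifies the limit of the differences
as the difference of the limit. -/
theorem isClosed_range (D : DirichletSetting p s c₀ δ hmin hmax Ω k h)
    [Fact (1 ≤ ENNReal.ofReal p)] :
    IsClosed (range (D.pairDiffLp ∘ₗ D.energyZeroSubmodule.subtype)) := by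
  obtain ⟨C, hC, hP⟩ := D.exists_norm_le
  refine IsSeqClosed.isClosed fun F f hF hf => ?_
  choose w hw using hF
  have hcauchy : CauchySeq fun n => (w n).1.1 := by
    have hFc := hf.cauchySeq
    rw [Metric.cauchySeq_iff] at hFc ⊢
    intro ε hε
    obtain ⟨n₀, hn₀⟩ := hFc (ε / (C + 1)) (by positivity)
    refine ⟨n₀, fun i hi j hj => ?_⟩
    have h1 := hn₀ i hi j hj
    have h2 := hP _ (w i - w j).2
    have h3 : D.pairDiffLp (w i - w j).1 = F i - F j := by
      rw [← hw i, ← hw j]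
      simp
    rw [dist_eq_norm, lt_div_iff₀ (by positivity)] at h1
    rw [h3] at h2
    rw [dist_eq_norm]
    calc ‖(w i).1.1 - (w j).1.1‖ ≤ C * ‖F i - F j‖ := h2
      _ ≤ ‖F i - F j‖ * (C + 1) := by nlinarith [norm_nonneg (F i - F j)]
      _ < ε := h1
  obtain ⟨v, hv⟩ := cauchySeq_tendsto_of_complete hcauchy
  obtain ⟨ns, hns, hvae⟩ := (tendstoInMeasure_of_tendsto_Lp hv).exists_seq_tendsto_ae
  obtain ⟨ms, hms, hfae⟩ := (tendstoInMeasure_of_tendsto_Lp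
    (hf.comp hns.tendsto_atTop)).exists_seq_tendsto_ae
  have hv0 : ∀ᵐ x ∂(volume.restrict (enlarged Ω δ \ Ω)), v x = 0 := by
    filter_upwards [ae_restrict_of_ae_restrict_of_subset sdiff_subset hvae,
      ae_all_iff.2 fun n => (w n).2] with x h1 h2
    refine tendsto_nhds_unique h1 ?_
    simp only [h2, tendsto_const_nhds_iff]
  have hfv : f =ᵐ[interactionMeasure Ω δ k p fun y' y => (h y' + h y) / 2] pairDiff v := by
    filter_upwards [hfae, interactionMeasure_absolutelyContinuous.ae_le (ae_pairMeasure_of_ae hvae),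
      ae_all_iff.2 fun n => D.coeFn_pairDiffLp (w n).1] with z h1 h2 h3
    refine tendsto_nhds_unique h1 ?_
    have h4 : ∀ i, F (ns (ms i)) z = pairDiff (w (ns (ms i))).1.1 z := fun i => by
      rw [← h3, ← hw]
      rfl
    simp only [Function.comp_apply, h4]
    exact (h2.2.sub h2.1).comp hms.tendsto_atTop
  -- `f` only gives finite weighted energy; the unweighted energy is finite because `v` vanishes
  -- outside `Ω`.
  have hvX : v ∈ energySpace Ω δ k p := by
    rw [D.mem_energySpace_iff,
      memLp_pairDiff_iff D.one_lt D.isKernel aemeasurable_const (aemeasurable_coe v)]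
    refine (lintegral_energy_le_weighted D.one_lt D.isKernel D.isCoefficient D.isOpen D.hmin_pos
      D.hmin_lt hv0).trans_lt (ENNReal.mul_lt_top ENNReal.ofReal_lt_top ?_)
    exact (memLp_pairDiff_iff D.one_lt D.isKernel D.isCoefficient.aemeasurable_average
      (aemeasurable_coe v)).1 ((Lp.memLp f).ae_eq hfv)
  refine ⟨⟨⟨v, hvX⟩, hv0⟩, Lp.ext ?_⟩
  exact (D.coeFn_pairDiffLp _).trans hfv.symm

theorem memLp_restrict (u : LpEnlarged Ω δ p) :
    MemLp u (ENNReal.ofReal p) (volume.restrict Ω) :=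
  (Lp.memLp u).mono_measure (Measure.restrict_mono (subset_enlarged Ω δ) le_rfl)

theorem integrable_source_mul (hp : 1 < p)
    (hg : MemLp g (ENNReal.ofReal (p / (p - 1))) (volume.restrict Ω)) (u : LpEnlarged Ω δ p) :
    Integrable (fun x => g x * u x) (volume.restrict Ω) := by
  have hpq : (p / (p - 1)).HolderConjugate p := (Real.HolderConjugate.conjExponent hp).symm
  have := hpq.ennrealOfReal
  exact hg.integrable_mul (memLp_restrict u)

/-- The functional `u ↦ ∫_Ω g u`. -/
noncomputable def sourceFunctional (hp : 1 < p)
    (hg : MemLp g (ENNReal.ofReal (p / (p - 1))) (volume.restrict Ω)) :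
    LpEnlarged Ω δ p →ₗ[ℝ] ℝ where
  toFun u := ∫ x in Ω, g x * u x
  map_add' u v := by
    rw [← integral_add (integrable_source_mul hp hg u) (integrable_source_mul hp hg v)]
    refine integral_congr_ae ?_
    filter_upwards [ae_restrict_of_ae_restrict_of_subset (subset_enlarged Ω δ)
      (Lp.coeFn_add u v)] with x hx
    rw [hx, Pi.add_apply, mul_add]
  map_smul' c u := by
    rw [RingHom.id_apply, smul_eq_mul, ← integral_const_mul]
    refine integral_congr_ae ?_
    filter_upwards [ae_restrict_of_ae_restrict_of_subset (subset_enlarged Ω δ)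
      (Lp.coeFn_smul c u)] with x hx
    rw [hx, Pi.smul_apply, smul_eq_mul]
    ring

theorem exists_abs_sourceFunctional_le (hp : 1 < p)
    (hg : MemLp g (ENNReal.ofReal (p / (p - 1))) (volume.restrict Ω)) :
    ∃ C : ℝ, 0 ≤ C ∧ ∀ u : LpEnlarged Ω δ p, |sourceFunctional hp hg u| ≤ C * ‖u‖ := by
  have hp0 : 0 < p := by linarith
  have hpq : (p / (p - 1)).HolderConjugate p := (Real.HolderConjugate.conjExponent hp).symm
  refine ⟨(∫ x in Ω, ‖g x‖ ^ (p / (p - 1))) ^ (1 / (p / (p - 1))), by positivity, fun u => ?_⟩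
  have h1 := integral_mul_norm_le_Lp_mul_Lq hpq hg (memLp_restrict u)
  have h2 : (∫ x in Ω, ‖u x‖ ^ p) ^ (1 / p) ≤ ‖u‖ := by
    have hu : 0 ≤ ‖u‖ := by rw [Lp.norm_def]; positivity
    rw [one_div, Real.rpow_inv_le_iff_of_pos (by positivity) hu hp0,
      Lp.norm_rpow_eq_integral hp]
    exact setIntegral_mono_set ((Lp.memLp u).integrable_abs_rpow hp)
      (Filter.Eventually.of_forall fun x => by positivity) (subset_enlarged Ω δ).eventuallyLE
  calc |sourceFunctional hp hg u| ≤ ∫ x in Ω, ‖g x * u x‖ :=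
        norm_integral_le_integral_norm fun x => g x * u x
    _ = ∫ x in Ω, ‖g x‖ * ‖u x‖ := by simp only [norm_mul]
    _ ≤ _ := h1.trans (mul_le_mul_of_nonneg_left h2 (by positivity))

/-! ### Solutions as minimizers, existence and uniqueness. -/

theorem functionalJ_add_smul (D : DirichletSetting p s c₀ δ hmin hmax Ω k h)
    (hg : MemLp g (ENNReal.ofReal (p / (p - 1))) (volume.restrict Ω))
    (u w : D.energySubmodule) (t : ℝ) :
    functionalJ Ω δ k p h g (u + t • w : D.energySubmodule).1 =
      1 / p * ∫ z, |pairDiff u.1 z + t * pairDiff w.1 z| ^ p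
        ∂interactionMeasure Ω δ k p (fun y' y => (h y' + h y) / 2) -
      (sourceFunctional D.one_lt hg u.1 + t * sourceFunctional D.one_lt hg w.1) := by
  have h1 : ∫ x in Ω, g x * (u + t • w : D.energySubmodule).1 x =
      sourceFunctional D.one_lt hg (u.1 + t • w.1) := rfl
  rw [functionalJ, D.weightedForm_self, h1, map_add, map_smul, smul_eq_mul]
  congr 2
  refine integral_congr_ae (interactionMeasure_absolutelyContinuous.ae_le ?_)
  filter_upwards [pairDiff_coe_add u.1 (t • w.1), pairDiff_coe_smul t w.1] with z h2 h3
  rw [Submodule.coe_add, Submodule.coe_smul, h2, Pi.add_apply, h3, Pi.smul_apply, smul_eq_mul]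

theorem sub_mem_zero (D : DirichletSetting p s c₀ δ hmin hmax Ω k h)
    {u v : D.energySubmodule} (hu : u.1 ∈ admissible Ω δ k p u₀)
    (hv : v.1 ∈ admissible Ω δ k p u₀) : v - u ∈ D.energyZeroSubmodule := by
  filter_upwards [hu.2, hv.2,
    ae_restrict_of_ae_restrict_of_subset sdiff_subset (Lp.coeFn_sub v.1 u.1)] with x h1 h2 h3
  rw [Submodule.coe_sub, h3, Pi.sub_apply, h1, h2, sub_self]

theorem add_mem_admissible (D : DirichletSetting p s c₀ δ hmin hmax Ω k h)
    {u w : D.energySubmodule} (hu : u.1 ∈ admissible Ω δ k p u₀)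
    (hw : w ∈ D.energyZeroSubmodule) : (u + w).1 ∈ admissible Ω δ k p u₀ := by
  refine ⟨(u + w).2, ?_⟩
  filter_upwards [hu.2, hw,
    ae_restrict_of_ae_restrict_of_subset sdiff_subset (Lp.coeFn_add u.1 w.1)] with x h1 h2 h3
  rw [Submodule.coe_add, h3, Pi.add_apply, h1, h2, add_zero]

theorem isSolution_iff_isMinOn (D : DirichletSetting p s c₀ δ hmin hmax Ω k h)
    (hg : MemLp g (ENNReal.ofReal (p / (p - 1))) (volume.restrict Ω)) {u : LpEnlarged Ω δ p}
    (hu : u ∈ admissible Ω δ k p u₀) :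
    IsSolution Ω δ k p h g u₀ u ↔
      IsMinOn (functionalJ Ω δ k p h g) (admissible Ω δ k p u₀) u := by
  have hp0 : 0 < p := by linarith [D.one_lt]
  set U : D.energySubmodule := ⟨u, hu.1⟩ with hU
  have hJ := D.functionalJ_add_smul hg U
  have hJ0 : functionalJ Ω δ k p h g u = 1 / p * ∫ z, |pairDiff u z| ^ p
      ∂interactionMeasure Ω δ k p (fun y' y => (h y' + h y) / 2) -
        sourceFunctional D.one_lt hg u := by
    simpa using hJ 0 0
  constructor
  · intro hsol
    refine isMinOn_iff.2 fun v hv => ?_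
    set V : D.energySubmodule := ⟨v, hv.1⟩ with hV
    have hw : V - U ∈ D.energyZeroSubmodule := D.sub_mem_zero hu hv
    have h1 := hJ (V - U) 1
    have h2 : (U + (1 : ℝ) • (V - U)).1 = v := by rw [one_smul, add_sub_cancel]
    have h3 : weightedForm Ω δ k p h u (V - U).1 = sourceFunctional D.one_lt hg (V - U).1 :=
      hsol.2 _ ⟨(V - U).2, hw⟩
    -- The subgradient inequality at `u` in direction `v - u`; the equation turns its first-order
    -- term into the source term.
    have h4 := integral_abs_rpow_add_le D.one_lt (D.memLp_pairDiff U) (D.memLp_pairDiff (V - U))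
    rw [← D.weightedForm_eq, h3] at h4
    simp only [one_mul] at h1
    rw [← h2, h1, hJ0]
    have h5 := mul_le_mul_of_nonneg_left h4 (one_div_nonneg.2 hp0.le)
    rw [mul_add, ← mul_assoc, one_div_mul_cancel hp0.ne', one_mul] at h5
    linarith
  · intro hmin
    refine ⟨hu, fun w hw => ?_⟩
    set W : D.energySubmodule := ⟨w, hw.1⟩ with hW
    have h1 : HasDerivAt (fun t : ℝ => functionalJ Ω δ k p h g (U + t • W).1)
        (1 / p * (p * weightedForm Ω δ k p h u w) - sourceFunctional D.one_lt hg w) 0 := by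
      simp only [hJ W]
      have h2 := hasDerivAt_integral_abs_rpow D.one_lt (D.memLp_pairDiff U) (D.memLp_pairDiff W)
      rw [← D.weightedForm_eq] at h2
      have h3 : HasDerivAt (fun t : ℝ => sourceFunctional D.one_lt hg u +
          t * sourceFunctional D.one_lt hg w) (sourceFunctional D.one_lt hg w) 0 := by
        simpa using ((hasDerivAt_id (0 : ℝ)).mul_const
          (sourceFunctional D.one_lt hg w)).const_add (sourceFunctional D.one_lt hg u)
      exact (h2.const_mul (1 / p)).sub h3
    -- The line `u + t w` stays admissible for every real `t`, so the derivative at `0` vanishes,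
    -- which is the weak equation tested with `w`.
    have h2 : IsLocalMin (fun t : ℝ => functionalJ Ω δ k p h g (U + t • W).1) 0 := by
      refine Filter.Eventually.of_forall fun t => ?_
      have h3 : t • W ∈ D.energyZeroSubmodule := D.energyZeroSubmodule.smul_mem t hw.2
      simp only [zero_smul, add_zero]
      exact isMinOn_iff.1 hmin _ (D.add_mem_admissible hu h3)
    have h3 := h2.hasDerivAt_eq_zero h1
    rw [← mul_assoc, one_div_mul_cancel hp0.ne', one_mul, sub_eq_zero] at h3
    exact h3

theorem existsUnique_isSolution (D : DirichletSetting p s c₀ δ hmin hmax Ω k h)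
    (hu₀ : u₀ ∈ traceSpace Ω δ k p)
    (hg : MemLp g (ENNReal.ofReal (p / (p - 1))) (volume.restrict Ω)) :
    ∃! u : LpEnlarged Ω δ p, IsSolution Ω δ k p h g u₀ u := by
  have hp0 : 0 < p := by linarith [D.one_lt]
  have : Fact (1 ≤ ENNReal.ofReal p) := ⟨by simpa using D.one_lt.le⟩
  obtain ⟨u₁, hu₁, hu₁0⟩ := hu₀
  set U : D.energySubmodule := ⟨u₁, hu₁⟩
  have hU : U.1 ∈ admissible Ω δ k p u₀ := ⟨hu₁, hu₁0⟩
  obtain ⟨C₁, hC₁, hP⟩ := D.exists_norm_le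
  obtain ⟨C₂, hC₂, hS⟩ := exists_abs_sourceFunctional_le (δ := δ) D.one_lt hg
  set T := D.pairDiffLp ∘ₗ D.energyZeroSubmodule.subtype with hT
  set ℓ := sourceFunctional D.one_lt hg ∘ₗ D.energySubmodule.subtype ∘ₗ
    D.energyZeroSubmodule.subtype with hℓ
  have hbound : ∀ v, |ℓ v| ≤ C₂ * C₁ * ‖T v‖ := fun v => by
    refine (hS v.1.1).trans ?_
    rw [mul_assoc]
    exact mul_le_mul_of_nonneg_left (hP v.1 v.2) hC₂
  have hJ : ∀ w : D.energyZeroSubmodule, functionalJ Ω δ k p h g (U + w.1).1 =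
      1 / p * ‖D.pairDiffLp U + T w‖ ^ p - ℓ w - sourceFunctional D.one_lt hg u₁ := fun w => by
    have h1 : ∫ x in Ω, g x * (U + w.1).1 x = sourceFunctional D.one_lt hg (u₁ + w.1.1) := rfl
    rw [functionalJ, D.weightedForm_self, D.integral_abs_pairDiff, h1, map_add, map_add]
    simp only [hT, hℓ, LinearMap.comp_apply, Submodule.subtype_apply]
    ring
  -- The constant `∫ g u₁` in `hJ` is the same for all competitors and drops out.
  have hmin : ∀ v : D.energyZeroSubmodule, IsSolution Ω δ k p h g u₀ (U + v.1).1 ↔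
      ∀ w, 1 / p * ‖D.pairDiffLp U + T v‖ ^ p - ℓ v ≤
        1 / p * ‖D.pairDiffLp U + T w‖ ^ p - ℓ w := fun v => by
    rw [D.isSolution_iff_isMinOn hg (D.add_mem_admissible hU v.2), isMinOn_iff]
    constructor
    · intro h1 w
      have h2 := h1 _ (D.add_mem_admissible hU w.2)
      rw [hJ, hJ] at h2
      linarith
    · intro h1 y hy
      have h2 := h1 ⟨_, D.sub_mem_zero (v := ⟨y, hy.1⟩) hU hy⟩
      have h3 := hJ ⟨_, D.sub_mem_zero (v := ⟨y, hy.1⟩) hU hy⟩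
      rw [add_sub_cancel] at h3
      rw [hJ, h3]
      linarith
  obtain ⟨v, hv⟩ := exists_minimizer_of_uniformlyConvex D.one_lt
    (fun ε hε => Lp.uniformlyConvex D.one_lt hε) T D.isClosed_range ℓ (mul_nonneg hC₂ hC₁) hbound
    (D.pairDiffLp U)
  refine ⟨(U + v.1).1, (hmin v).2 hv, fun y hy => ?_⟩
  set Y : D.energySubmodule := ⟨y, hy.1.1⟩ with hY
  set v' : D.energyZeroSubmodule := ⟨Y - U, D.sub_mem_zero hU hy.1⟩ with hv'
  have hyv : (U + v'.1).1 = y := by rw [hv', add_sub_cancel]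
  have h1 := (hmin v').1 (by rwa [hyv])
  have h2 := eq_of_minimizers_of_uniformlyConvex D.one_lt
    (fun ε hε => Lp.uniformlyConvex D.one_lt hε) T ℓ (D.pairDiffLp U) hv h1
  -- `T` is injective on `X₀` by the Poincaré bound `hP`.
  have h3 : ‖(v - v').1.1‖ ≤ 0 := by
    refine (hP _ (v - v').2).trans ?_
    have h4 : D.pairDiffLp (v - v').1 = T v - T v' := by simp [hT]
    rw [h4, h2, sub_self, norm_zero, mul_zero]
  have h4 : v.1.1 = v'.1.1 := sub_eq_zero.1 (norm_le_zero_iff.1 h3)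
  rw [← hyv, Submodule.coe_add, Submodule.coe_add, h4]

end DirichletSetting

theorem mainTheorem6 (N : ℕ) (p s c₀ δ hmin hmax : ℝ) (hp : 1 < p) (hs₀ : 0 < s) (hs₁ : s < 1)
    (hN : p * s < (N : ℝ)) (hc₀ : 0 < c₀) (hδ : 0 < δ) (hmin_pos : 0 < hmin)
    (hmin_lt : hmin < hmax)
    (Ω : Set (Euc N)) (hΩ_open : IsOpen Ω) (hΩ_bdd : Bornology.IsBounded Ω)
    (k : ℝ → ℝ) (hk : IsKernel N p s c₀ δ k)
    (h : Euc N → ℝ) (hh : IsCoefficient Ω δ hmin hmax h)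
    (u₀ : Euc N → ℝ) (hu₀ : u₀ ∈ traceSpace Ω δ k p)
    (g : Euc N → ℝ) (hg : MemLp g (ENNReal.ofReal (p / (p - 1))) (volume.restrict Ω)) :
    (∃! u : LpEnlarged Ω δ p, IsSolution Ω δ k p h g u₀ u) ∧
      ∀ u ∈ admissible Ω δ k p u₀,
        (IsSolution Ω δ k p h g u₀ u ↔
          IsMinOn (functionalJ Ω δ k p h g) (admissible Ω δ k p u₀) u) := by
  have hN0 : 0 < N := by
    have : (0 : ℝ) < N := (mul_pos (by linarith) hs₀).trans hN
    exact_mod_cast this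
  have D : DirichletSetting p s c₀ δ hmin hmax Ω k h :=
    ⟨hp, hs₀, hc₀, hδ, hmin_pos, hmin_lt, hN0, hΩ_open, hΩ_bdd, hk, hh⟩
  exact ⟨D.existsUnique_isSolution hu₀ hg, fun u hu => D.isSolution_iff_isMinOn hg hu⟩
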